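/- All graphs are finite, simple and undirected. A graph is \emph{CIS} if every inclusion-maximal stable set and every inclusion-maximal clique have a common vertex; it is \emph{well-covered} if all its inclusion-maximal stable sets have the same size, \emph{co-well-covered} if its complement is well-covered, and \emph{irreducible} if no two distinct vertices have the same (open) neighborhood. For graphs $\Gamma_1,\Gamma_2$, the lexicographic product $\Gamma_1[\Gamma_2]$ has vertex set $V(\Gamma_1)\times V(\Gamma_2)$, with $(u,x)$ and $(v,y)$ adjacent if and only if either $\{u,v\}\in E(\Gamma_1)$, or $u=v$ and $\{x,y\}\in E(\Gamma_2)$. $L(\Gamma)$ denotes the line graph of $\Gamma$. For $n\ge 4$, let $Q_n$ be the graph with vertex set $\mathbb{Z}_n\times\mathbb{Z}_2\times\mathbb{Z}_2$ whose edges are the pairs $\{(i,x,y),(i+1,y,z)\}$ with $i\in\mathbb{Z}_n$ and $x,y,z\in\mathbb{Z}_2$, together with the pairs $\{(i,x,y),(i,u,v)\}$ with $i\in\mathbb{Z}_n$, $x,y,u,v\in\mathbb{Z}_2$ and $(x,y)\neq(u,v)$. \textbf{Theorem.} Let $\Gamma$ be a connected, $k$-regular, irreducible, well-covered and co-well-covered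 CIS graph. If $k\le 7$, then $\Gamma$ is either a complete graph or isomorphic to one of $L(K_{3,3})$, $L(K_{4,4})$, $C_4[K_2]$, $K_{3,3}[K_2]$, or $Q_n$ for some $n\ge 4$. -/

import Mathlib

namespace SimpleGraph

/-- A graph is CIS if every maximal clique and every maximal stable set intersect.
Maximality is with respect to inclusion. -/
def IsCIS {V : Type*} (G : SimpleGraph V) : Prop :=
  ∀ C S : Set V, Maximal G.IsClique C → Maximal G.IsIndepSet S → (C ∩ S).Nonempty

/-- A graph is well-covered if all its (inclusion-)maximal stable sets have the same size. -/
def IsWellCovered {V : Type*} (G : SimpleGraph V) : Prop :=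
  ∀ S T : Set V, Maximal G.IsIndepSet S → Maximal G.IsIndepSet T → S.encard = T.encard

/-- A graph is co-well-covered if its complement is well-covered. -/
def IsCoWellCovered {V : Type*} (G : SimpleGraph V) : Prop :=
  Gᶜ.IsWellCovered

/-- A graph is irreducible if no two distinct vertices have the same (open) neighborhood. -/
def IsIrreducible {V : Type*} (G : SimpleGraph V) : Prop :=
  ∀ u v : V, G.neighborSet u = G.neighborSet v → u = v

/-- The lexicographic product `G[H]`. -/
def lexProduct {V W : Type*} (G : SimpleGraph V) (H : SimpleGraph W) :
    SimpleGraph (V × W) where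
  Adj p q := G.Adj p.1 q.1 ∨ (p.1 = q.1 ∧ H.Adj p.2 q.2)
  symm := ⟨fun _ _ h => h.imp (fun h => h.symm) (fun h => ⟨h.1.symm, h.2.symm⟩)⟩
  loopless := ⟨fun p h => h.elim (fun h => G.loopless.irrefl p.1 h)
    (fun h => H.loopless.irrefl p.2 h.2)⟩

/-- The graph `PX(n)`: its edges are the pairs `{(i, x, y), (i + 1, y, z)}`. -/
def praegerXu (n : ℕ) : SimpleGraph (ZMod n × ZMod 2 × ZMod 2) :=
  fromRel fun p q => q.1 = p.1 + 1 ∧ q.2.1 = p.2.2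

/-- The graph `Q_n`, obtained from `PX(n)` by joining any two distinct vertices which have the
same first coordinate. -/
def graphQ (n : ℕ) : SimpleGraph (ZMod n × ZMod 2 × ZMod 2) :=
  praegerXu n ⊔ fromRel fun p q => p.1 = q.1

end SimpleGraph

open Finset

namespace SimpleGraph

/-! ### Clique sizes and the basic intersection bound -/

variable {V : Type*} {G : SimpleGraph V} {m k n : ℕ}

/-! Co-well-coveredness gives all maximal cliques one size `m`. The CIS property says that no stable
set dominates a maximal clique: a maximal stable set above it meets the clique in a vertex without
neighbours in it. With regularity and irreducibility this yields the basic rigidity `CISData.near`: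
a vertex outside an `m`-clique has at most `m - 2` neighbours in it, so two `m`-cliques share at
most `m - 2` vertices.

A vertex of an `m`-clique has `k + 1 - m` outer neighbours, and for `k ≤ 7` this leaves few cases.
If `m ≤ 2` or `k < m` the graph is complete; otherwise `m = k` and `m ≥ 5` are impossible. For `m =
3` every edge lies in one triangle, so `k` is even; `k = 4` gives a rook's graph, while `k = 6`
would produce a stable triple dominating a triangle or an edge in two triangles. For `m = 4`,
valency 5 forces `C_4[K_2]`, and valency 6 makes cliques meet in at most one vertex, again giving a
rook's graph (`GridData.exists_iso`).

The main case is `m = 4`, `k = 7` (`CISData.twin_or_linePath`). At each vertex, three cliques either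
share an edge, whose ends are then twins, or form a path. Twins propagate to neighbouring pairs and
give `K_{3,3}[K_2]`. If all vertices give paths, the edges lying in two cliques form 4-cycles, each
spanning a clique called a layer. Every layer has a successor (`PathData.exists_next`); by
finiteness the sequence of layers closes up cyclically, and counting valencies shows that nothing
else is present. Cycles of two or three layers contradict the clique structure, which leaves `Q_n`
with `n ≥ 4`. -/

/-- The combinatorial data extracted from a regular, irreducible, co-well-covered CIS graph:
every clique extends to one of size `m`, no stable set dominates an `m`-clique, every vertex
has `k` neighbours. -/
structure CISData (G : SimpleGraph V) (m k : ℕ) : Prop where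
  ext : ∀ s : Finset V, G.IsClique (s : Set V) → ∃ t, s ⊆ t ∧ G.IsNClique m t
  cis : ∀ C : Finset V, G.IsNClique m C → ∀ S : Finset V, G.IsIndepSet (S : Set V) →
    ∃ c ∈ C, ∀ s ∈ S, ¬ G.Adj c s
  reg : ∀ v, ∃ N : Finset V, N.card = k ∧ ∀ u, u ∈ N ↔ G.Adj v u
  irr : G.IsIrreducible

theorem exists_cisData [Fintype V] [Nonempty V] [DecidableRel G.Adj]
    (hreg : G.IsRegularOfDegree k) (hirr : G.IsIrreducible)
    (hcwc : G.IsCoWellCovered) (hcis : G.IsCIS) : ∃ m, CISData G m k := by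
  classical
  have key : ∀ s : Set V, G.IsClique s → ∃ t, s ⊆ t ∧ Maximal G.IsClique t := fun s hs =>
    Finite.exists_le_maximal hs
  have key' : ∀ s : Set V, G.IsIndepSet s → ∃ t, s ⊆ t ∧ Maximal G.IsIndepSet t := fun s hs =>
    Finite.exists_le_maximal hs
  obtain ⟨C₀, -, hC₀⟩ := key ∅ (by simp)
  have hsize : ∀ C, Maximal G.IsClique C → C.encard = C₀.encard := by
    intro C hC
    refine hcwc C C₀ ?_ ?_
    · simpa [Maximal] using hC
    · simpa [Maximal] using hC₀
  have hmax : ∀ C : Finset V, G.IsNClique C₀.ncard C → Maximal G.IsClique (C : Set V) := by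
    intro C hC
    obtain ⟨t, ht, htm⟩ := key _ hC.isClique
    have h1 := hsize t htm
    have h2 : (C : Set V).encard = C₀.encard := by
      rw [Set.encard_coe_eq_coe_finsetCard, hC.card_eq, (Set.toFinite C₀).cast_ncard_eq]
    have : (C : Set V) = t := (Set.toFinite (C : Set V)).eq_of_subset_of_encard_le ht (by rw [h1, h2])
    rwa [this]
  refine ⟨C₀.ncard, ?_, ?_, ?_, hirr⟩
  · intro s hs
    obtain ⟨t, ht, htm⟩ := key s hs
    refine ⟨t.toFinset, by simpa [← Finset.coe_subset] using ht, ?_, ?_⟩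
    · simpa using htm.prop
    · rw [← Set.ncard_eq_toFinset_card', Set.ncard, hsize t htm, Set.ncard]
  · intro C hC S hS
    obtain ⟨T, hT, hTm⟩ := key' S hS
    obtain ⟨c, hc, hcT⟩ := hcis C T (hmax C hC) hTm
    refine ⟨c, hc, fun s hs hadj => ?_⟩
    exact hTm.prop hcT (hT hs) hadj.ne hadj
  · intro v
    exact ⟨G.neighborFinset v, hreg v, fun u => by simp⟩

namespace CISData

variable (h : CISData G m k)
include h

theorem card_clique_le {s : Finset V} (hs : G.IsClique (s : Set V)) : s.card ≤ m := by
  obtain ⟨t, ht, htm⟩ := h.ext s hs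
  exact htm.card_eq ▸ card_le_card ht

theorem nbr_eq {v : V} {N : Finset V} (hN : ∀ u ∈ N, G.Adj v u) (hc : k ≤ N.card) (u : V) :
    G.Adj v u ↔ u ∈ N := by
  obtain ⟨M, hM, hMu⟩ := h.reg v
  have : N = M := eq_of_subset_of_card_le (fun u hu => (hMu u).2 (hN u hu)) (by omega)
  rw [this, hMu]

/-- A vertex outside a maximum clique has at most `m - 2` neighbours in it. -/
theorem near {C : Finset V} (hC : G.IsNClique m C) {u : V} (hu : u ∉ C) {T : Finset V}
    (hTC : T ⊆ C) (hT : ∀ t ∈ T, G.Adj u t) : T.card + 2 ≤ m := by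
  classical
  by_contra hlt
  have hins : G.IsClique ((insert u T : Finset V) : Set V) := by
    rw [coe_insert, isClique_insert]
    exact ⟨hC.isClique.subset (by exact_mod_cast hTC), fun b hb _ => hT b hb⟩
  have h1 := h.card_clique_le hins
  rw [card_insert_of_notMem (fun hh => hu (hTC hh))] at h1
  have hcard : (C \ T).card = 1 := by
    rw [card_sdiff_of_subset hTC, hC.card_eq]; omega
  obtain ⟨w, hw⟩ := card_eq_one.1 hcard
  have hw' : ∀ x, x ∈ C ∧ x ∉ T ↔ x = w := fun x => by
    rw [← mem_sdiff, hw, mem_singleton]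
  obtain ⟨hwC, hwT⟩ := (hw' w).2 rfl
  have hnuw : ¬ G.Adj u w := by
    intro hh
    have : G.IsClique ((insert u C : Finset V) : Set V) := by
      rw [coe_insert, isClique_insert]
      refine ⟨hC.isClique, fun b hb _ => ?_⟩
      by_cases hbT : b ∈ T
      · exact hT b hbT
      · rw [(hw' b).1 ⟨hb, hbT⟩]; exact hh
    have := h.card_clique_le this
    rw [card_insert_of_notMem hu, hC.card_eq] at this
    omega
  -- A neighbour `x` of `w` off `C` that misses `u` would make the stable pair `{x, u}` dominate
  -- `C`: `x` covers `w` and `u` covers `T`. Hence `N(w) ⊆ N(u)`, and regularity with irreducibility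
  -- forces `w = u`.
  have hsub : ∀ x, G.Adj w x → G.Adj u x := by
    intro x hx
    by_cases hxC : x ∈ C
    · by_cases hxT : x ∈ T
      · exact hT x hxT
      · exact absurd ((hw' x).1 ⟨hxC, hxT⟩) hx.ne'
    · by_contra hux
      obtain ⟨c, hc, hcS⟩ := h.cis C hC {x, u} (by
        intro a ha b hb hab
        simp only [coe_insert, coe_singleton, Set.mem_insert_iff, Set.mem_singleton_iff] at ha hb
        rcases ha with rfl | rfl <;> rcases hb with rfl | rfl
        · exact absurd rfl hab
        · exact fun hh => hux hh.symm
        · exact hux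
        · exact absurd rfl hab)
      by_cases hcT : c ∈ T
      · exact hcS u (by simp) (hT c hcT).symm
      · rw [(hw' c).1 ⟨hc, hcT⟩] at hcS
        exact hcS x (by simp) hx
  obtain ⟨N, hN, hNw⟩ := h.reg w
  have := h.nbr_eq (v := u) (N := N) (fun x hx => hsub x ((hNw x).1 hx)) hN.ge
  have huw : w = u := h.irr w u (by ext x; simp [this, hNw])
  exact hu (huw ▸ hwC)

theorem card_inter [DecidableEq V] {C D : Finset V} (hC : G.IsNClique m C)
    (hD : G.IsNClique m D) (hne : C ≠ D) : (C ∩ D).card + 2 ≤ m := by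
  obtain ⟨u, huD, huC⟩ : ∃ u ∈ D, u ∉ C := by
    by_contra hh
    push Not at hh
    exact hne (eq_of_subset_of_card_le hh (by rw [hC.card_eq, hD.card_eq])).symm
  refine h.near hC huC inter_subset_left fun t ht => ?_
  rw [mem_inter] at ht
  exact hD.isClique huD ht.2 (fun hh => huC (hh ▸ ht.1))

theorem exists_clique {u v : V} (huv : G.Adj u v) : ∃ C, G.IsNClique m C ∧ u ∈ C ∧ v ∈ C := by
  classical
  obtain ⟨t, ht, htm⟩ := h.ext {u, v} (by simp [huv])
  exact ⟨t, htm, ht (by simp), ht (by simp)⟩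

end CISData

/-! ### Recognising a connected graph from an embedded copy -/

theorem Connected.forall_mem_of_closed (hG : G.Connected) {s : Set V} (hs : s.Nonempty)
    (hcl : ∀ u ∈ s, ∀ v, G.Adj u v → v ∈ s) (v : V) : v ∈ s := by
  obtain ⟨u, hu⟩ := hs
  obtain ⟨p⟩ := hG.preconnected u v
  induction p with
  | nil => exact hu
  | cons hadj _ ih => exact ih (hcl _ hu _ hadj)

/-- An injective homomorphism whose image is closed under adjacency is an isomorphism onto a
connected graph. -/
theorem Connected.nonempty_iso_of_closed {W : Type*} [Nonempty W] {H : SimpleGraph W}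
    (hG : G.Connected) (f : W → V) (hf : Function.Injective f)
    (hom : ∀ a b, H.Adj a b → G.Adj (f a) (f b))
    (hcl : ∀ a v, G.Adj (f a) v → ∃ b, H.Adj a b ∧ f b = v) : Nonempty (G ≃g H) := by
  have hsurj : Function.Surjective f := fun v =>
    hG.forall_mem_of_closed (s := Set.range f) (Set.range_nonempty f) (by
      rintro _ ⟨a, rfl⟩ v hv
      obtain ⟨b, -, hb⟩ := hcl a v hv
      exact ⟨b, hb⟩) v
  refine ⟨Iso.symm ⟨Equiv.ofBijective f ⟨hf, hsurj⟩, ?_⟩⟩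
  intro a b
  refine ⟨fun hab => ?_, hom a b⟩
  obtain ⟨b', hb', hfb⟩ := hcl a _ hab
  rwa [← hf hfb]

/-- The images of the neighbours already fill the valency `k`, so the image is closed under
adjacency. -/
theorem Connected.nonempty_iso_of_degree {W : Type*} [Nonempty W] [Fintype W]
    {H : SimpleGraph W} [DecidableRel H.Adj] (hG : G.Connected) (h : CISData G m k)
    (f : W → V) (hf : Function.Injective f)
    (hom : ∀ a b, H.Adj a b → G.Adj (f a) (f b)) (hdeg : ∀ a, k ≤ H.degree a) :
    Nonempty (G ≃g H) := by
  classical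
  refine hG.nonempty_iso_of_closed f hf hom fun a v hv => ?_
  rw [h.nbr_eq (N := (H.neighborFinset a).image f)
    (by simpa using fun b hb => hom a b hb)
    (by rw [card_image_of_injective _ hf]; exact hdeg a)] at hv
  simpa using hv

/-! ### Complete graphs, and the exclusion of large cliques -/

namespace CISData

variable (h : CISData G m k)
include h

theorem eq_top_of_closed (hG : G.Connected) {C : Finset V} (hC : G.IsNClique m C)
    (hcl : ∀ v ∈ C, ∀ u, G.Adj v u → u ∈ C) : G = ⊤ := by
  have hne : (C : Set V).Nonempty := by
    rw [coe_nonempty, nonempty_iff_ne_empty]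
    rintro rfl
    obtain ⟨v⟩ := hG.nonempty
    have := h.card_clique_le (s := {v}) (by simp)
    have := hC.card_eq
    simp at *
    omega
  have hall : ∀ v, v ∈ C := hG.forall_mem_of_closed hne (fun u hu v huv => hcl u hu v huv)
  ext a b
  rw [top_adj]
  exact ⟨fun hab => hab.ne, fun hab => hC.isClique (hall a) (hall b) hab⟩

theorem exists_nclique : ∃ C, G.IsNClique m C := by
  obtain ⟨t, -, ht⟩ := h.ext ∅ (by simp)
  exact ⟨t, ht⟩

theorem eq_top_of_le_two (hG : G.Connected) (hm : m ≤ 2) : G = ⊤ := by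
  obtain ⟨C, hC⟩ := h.exists_nclique
  refine h.eq_top_of_closed hG hC fun v hv u hvu => ?_
  by_contra hu
  have := h.near hC hu (T := {v}) (by simpa using hv) (by simpa using hvu.symm)
  simp at this
  omega

theorem eq_top_of_lt (hG : G.Connected) (hm : k < m) : G = ⊤ := by
  classical
  obtain ⟨C, hC⟩ := h.exists_nclique
  refine h.eq_top_of_closed hG hC fun v hv u hvu => ?_
  rw [h.nbr_eq (N := C.erase v)
    (fun x hx => hC.isClique hv (mem_of_mem_erase hx) (ne_of_mem_erase hx).symm)
    (by rw [card_erase_of_mem hv, hC.card_eq]; omega)] at hvu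
  exact mem_of_mem_erase hvu

/-- The neighbours of a vertex of a maximum clique outside the clique. -/
theorem exists_outer [DecidableEq V] {C : Finset V} (hC : G.IsNClique m C) {v : V}
    (hv : v ∈ C) : ∃ O : Finset V, O.card + m = k + 1 ∧ ∀ u, u ∈ O ↔ G.Adj v u ∧ u ∉ C := by
  obtain ⟨N, hN, hNv⟩ := h.reg v
  have hsub : C.erase v ⊆ N := fun x hx =>
    (hNv x).2 (hC.isClique hv (mem_of_mem_erase hx) (ne_of_mem_erase hx).symm)
  refine ⟨N \ C.erase v, ?_, fun u => ?_⟩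
  · have := card_sdiff_add_card_eq_card hsub
    rw [card_erase_of_mem hv, hC.card_eq] at this
    have : 0 < m := hC.card_eq ▸ card_pos.2 ⟨v, hv⟩
    omega
  · rw [mem_sdiff, hNv, mem_erase]
    exact ⟨fun hh => ⟨hh.1, fun hu => hh.2 ⟨hh.1.ne', hu⟩⟩, fun hh => ⟨hh.1, fun hu => hh.2 hu.2⟩⟩

theorem exists_other_clique [DecidableEq V] (hkm : m ≤ k) {C : Finset V}
    (hC : G.IsNClique m C) {v : V} (hv : v ∈ C) :
    ∃ D, G.IsNClique m D ∧ v ∈ D ∧ C ≠ D := by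
  obtain ⟨O, hO, hOv⟩ := h.exists_outer hC hv
  obtain ⟨u, hu⟩ := card_pos.1 (show 0 < O.card by omega)
  rw [hOv] at hu
  obtain ⟨D, hD, hvD, huD⟩ := h.exists_clique hu.1
  exact ⟨D, hD, hvD, fun hh => hu.2 (hh ▸ huD)⟩

omit h in
theorem _root_.SimpleGraph.IsNClique.card_sdiff_add [DecidableEq V] {D : Finset V}
    (hD : G.IsNClique m D) (C : Finset V) : (D \ C).card + (C ∩ D).card = m := by
  rw [inter_comm, card_sdiff_add_card_inter, hD.card_eq]

omit h in
theorem _root_.SimpleGraph.IsNClique.sdiff_subset_outer [DecidableEq V] {C D O : Finset V} {v : V}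
    (hD : G.IsNClique m D) (hvC : v ∈ C) (hvD : v ∈ D) (hO : ∀ u, u ∈ O ↔ G.Adj v u ∧ u ∉ C) :
    D \ C ⊆ O := by
  intro u hu
  rw [mem_sdiff] at hu
  exact (hO u).2 ⟨hD.isClique hvD hu.1 (fun hh => hu.2 (hh ▸ hvC)), hu.2⟩

/-- With `m = k` a clique vertex has a single outer neighbour, but a second clique through it needs
at least two. -/
theorem ne_of_pos (hm : 0 < m) : m ≠ k := by
  classical
  intro hmk
  obtain ⟨C, hC⟩ := h.exists_nclique
  obtain ⟨v, hv⟩ := card_pos.1 (hC.card_eq.symm ▸ hm)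
  obtain ⟨D, hD, hvD, hCD⟩ := h.exists_other_clique hmk.le hC hv
  obtain ⟨O, hO, hOv⟩ := h.exists_outer hC hv
  have h1 := h.card_inter hC hD hCD
  have h2 := card_le_card (hD.sdiff_subset_outer hv hvD hOv)
  have h3 := hD.card_sdiff_add C
  omega

/-- A clique vertex has at most two outer neighbours, and a second clique `D` brings at least two,
so they are exactly `D \ C`. As `2(m - 2) > m`, the traces on `C` of two such cliques meet, which
forces `D \ C = E \ C`; a vertex there sees `m - 1` vertices of `C`. -/
theorem false_of_five_le_of_le_succ (hm : 5 ≤ m) (hkm : m ≤ k) (hk : k ≤ m + 1) : False := by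
  classical
  obtain ⟨C, hC⟩ := h.exists_nclique
  have key : ∀ D, G.IsNClique m D → C ≠ D → ∀ z ∈ C, z ∈ D → (C ∩ D).card + 2 = m ∧
      ∀ u, u ∈ D \ C ↔ G.Adj z u ∧ u ∉ C := by
    intro D hD hne z hzC hzD
    obtain ⟨O, hO, hOz⟩ := h.exists_outer hC hzC
    have h1 := h.card_inter hC hD hne
    have h2 := hD.sdiff_subset_outer hzC hzD hOz
    have h3 := card_le_card h2
    have h4 := hD.card_sdiff_add C
    have h5 : D \ C = O := eq_of_subset_of_card_le h2 (by omega)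
    exact ⟨by omega, by rwa [h5]⟩
  obtain ⟨v, hv⟩ := card_pos.1 (show 0 < C.card by rw [hC.card_eq]; omega)
  obtain ⟨D, hD, hvD, hCD⟩ := h.exists_other_clique hkm hC hv
  have hcD := (key D hD hCD v hv hvD).1
  have hCD' := hC.card_sdiff_add D
  rw [inter_comm] at hCD'
  obtain ⟨w, hw⟩ := card_pos.1 (show 0 < (C \ D).card by omega)
  rw [mem_sdiff] at hw
  obtain ⟨E, hE, hwE, hCE⟩ := h.exists_other_clique hkm hC hw.1
  have hcE := (key E hE hCE w hw.1 hwE).1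
  have hun : ((C ∩ D) ∪ (C ∩ E)).card ≤ m :=
    hC.card_eq ▸ card_le_card (union_subset inter_subset_left inter_subset_left)
  have hui := card_union_add_card_inter (C ∩ D) (C ∩ E)
  obtain ⟨z, hz⟩ := card_pos.1 (show 0 < ((C ∩ D) ∩ (C ∩ E)).card by omega)
  simp only [mem_inter] at hz
  have hDz := (key D hD hCD z hz.1.1 hz.1.2).2
  have hEz := (key E hE hCE z hz.1.1 hz.2.2).2
  have hD2 := hD.card_sdiff_add C
  obtain ⟨u, hu⟩ := card_pos.1 (show 0 < (D \ C).card by omega)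
  have huE : u ∈ E \ C := (hEz u).2 ((hDz u).1 hu)
  rw [mem_sdiff] at hu huE
  have := h.near hC hu.2 (T := insert w (C ∩ D))
    (insert_subset hw.1 inter_subset_left) (by
      intro t ht
      rw [mem_insert, mem_inter] at ht
      rcases ht with rfl | ht
      · exact hE.isClique huE.1 hwE (fun hh => hu.2 (hh ▸ hw.1))
      · exact hD.isClique hu.1 ht.2 (fun hh => hu.2 (hh ▸ ht.1)))
  rw [card_insert_of_notMem (by simp [hw.2])] at this
  omega

end CISData

/-- A clique vertex has three outer neighbours. Intersections of size three are ruled out first;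
then every clique meeting `C` does so in a pair, and overlapping pairs coincide, so five vertices
would be partitioned into pairs. -/
theorem CISData.false_of_five_seven (h : CISData G 5 7) : False := by
  classical
  have key : ∀ C D, G.IsNClique 5 C → G.IsNClique 5 D → (C ∩ D).card ≠ 3 := by
    intro C D hC hD h3
    obtain ⟨v, hv⟩ := card_pos.1 (show 0 < (C ∩ D).card by omega)
    rw [mem_inter] at hv
    obtain ⟨O, hO, hOv⟩ := h.exists_outer hC hv.1
    have h1 := hD.sdiff_subset_outer hv.1 hv.2 hOv
    have h2 := hD.card_sdiff_add C
    have h4 := card_sdiff_add_card_eq_card h1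
    obtain ⟨e, he⟩ := card_eq_one.1 (show (O \ (D \ C)).card = 1 by omega)
    have heO : e ∈ O \ (D \ C) := by simp [he]
    obtain ⟨heO, heDC⟩ := mem_sdiff.1 heO
    have heC := (hOv e).1 heO
    have heD : e ∉ D := fun hh => heDC (mem_sdiff.2 ⟨hh, heC.2⟩)
    obtain ⟨E, hE, hvE, heE⟩ := h.exists_clique heC.1
    have hsub : ∀ x ∈ E, x ≠ e → x ∈ C ∨ x ∈ D := by
      intro x hx hxe
      by_contra hh
      push Not at hh
      have : x ∈ O \ (D \ C) := by
        simp only [mem_sdiff, hOv]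
        exact ⟨⟨hE.isClique hvE hx (fun h' => hh.1 (h' ▸ hv.1)), hh.1⟩, fun h' => hh.2 h'.1⟩
      rw [he, mem_singleton] at this
      exact hxe this
    have hmk : ∀ A B : Finset V, G.IsNClique 5 A → e ∉ A →
        (∀ x ∈ E, x ≠ e → x ∈ A ∨ x ∈ B) → ∃ y ∈ E, y ∈ B ∧ y ∉ A ∧ y ≠ e := by
      intro A B hA heA hAB
      have h5 := h.card_inter hA hE (fun hh => heA (hh ▸ heE))
      have h6 := hE.card_sdiff_add A
      obtain ⟨y, hy, hye⟩ := exists_mem_ne (show 1 < (E \ A).card by omega) e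
      rw [mem_sdiff] at hy
      exact ⟨y, hy.1, (hAB y hy.1 hye).resolve_left hy.2, hy.2, hye⟩
    -- `E` has two vertices outside `C` and two outside `D`, only one of which can be `e`. The
    -- resulting `y` is adjacent to `x` and to all of `C ∩ D`, four vertices of `C`.
    obtain ⟨y, hyE, hyD, hyC, -⟩ := hmk C D hC heC.2 hsub
    obtain ⟨x, hxE, hxC, hxD, -⟩ := hmk D C hD heD (fun x hx hxe => (hsub x hx hxe).symm)
    have := h.near hC hyC (T := insert x (C ∩ D)) (insert_subset hxC inter_subset_left) (by
      intro t ht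
      rw [mem_insert, mem_inter] at ht
      rcases ht with rfl | ht
      · exact hE.isClique hyE hxE (fun hh => hyC (hh ▸ hxC))
      · exact hD.isClique hyD ht.2 (fun hh => hyC (hh ▸ ht.1)))
    rw [card_insert_of_notMem (by simp [hxD])] at this
    omega
  obtain ⟨C, hC⟩ := h.exists_nclique
  have key2 : ∀ D, G.IsNClique 5 D → C ≠ D → ∀ z ∈ C, z ∈ D → (C ∩ D).card = 2 ∧
      ∀ u, u ∈ D \ C ↔ G.Adj z u ∧ u ∉ C := by
    intro D hD hne z hzC hzD
    obtain ⟨O, hO, hOz⟩ := h.exists_outer hC hzC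
    have h1 := h.card_inter hC hD hne
    have h2 := hD.sdiff_subset_outer hzC hzD hOz
    have h3 := card_le_card h2
    have h4 := hD.card_sdiff_add C
    have h6 := key C D hC hD
    have h5 : D \ C = O := eq_of_subset_of_card_le h2 (by omega)
    exact ⟨by omega, by rwa [h5]⟩
  have key3 : ∀ D E, G.IsNClique 5 D → G.IsNClique 5 E → C ≠ D → C ≠ E →
      ¬ Disjoint (C ∩ D) (C ∩ E) → C ∩ E ⊆ C ∩ D := by
    intro D E hD hE hCD hCE hdis
    obtain ⟨z, hzD, hzE⟩ := not_disjoint_iff.1 hdis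
    rw [mem_inter] at hzD hzE
    obtain ⟨hD2, hDz⟩ := key2 D hD hCD z hzD.1 hzD.2
    obtain ⟨hE2, hEz⟩ := key2 E hE hCE z hzE.1 hzE.2
    intro w hw
    by_contra hwD
    rw [mem_inter] at hw
    -- The common vertex `z` gives `D \ C = E \ C`, so `w` is adjacent to all of `D`: a 6-clique.
    have hcl : G.IsClique ((insert w D : Finset V) : Set V) := by
      rw [coe_insert, isClique_insert]
      refine ⟨hD.isClique, fun b hb hwb => ?_⟩
      by_cases hbC : b ∈ C
      · exact hC.isClique hw.1 hbC hwb
      · have : b ∈ E \ C := (hEz b).2 ((hDz b).1 (mem_sdiff.2 ⟨hb, hbC⟩))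
        exact hE.isClique hw.2 (mem_sdiff.1 this).1 hwb
    have := h.card_clique_le hcl
    rw [card_insert_of_notMem (fun hh => hwD (mem_inter.2 ⟨hw.1, hh⟩)), hD.card_eq] at this
    omega
  have step : ∀ T : Finset V, T.card ≤ 4 → ∃ D, G.IsNClique 5 D ∧ C ≠ D ∧
      (C ∩ D).card = 2 ∧ ¬ C ∩ D ⊆ T := by
    intro T hT
    obtain ⟨v, hvC, hvT⟩ : ∃ v ∈ C, v ∉ T := by
      by_contra hh
      push Not at hh
      have := card_le_card (show C ⊆ T from hh)
      rw [hC.card_eq] at this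
      omega
    obtain ⟨D, hD, hvD, hCD⟩ := h.exists_other_clique (by norm_num) hC hvC
    exact ⟨D, hD, hCD, (key2 D hD hCD v hvC hvD).1, fun hh => hvT (hh (mem_inter.2 ⟨hvC, hvD⟩))⟩
  obtain ⟨D₁, hD₁, hC₁, h₁, -⟩ := step ∅ (by simp)
  obtain ⟨D₂, hD₂, hC₂, h₂, hn₂⟩ := step (C ∩ D₁) (by omega)
  have d12 : Disjoint (C ∩ D₁) (C ∩ D₂) := by
    by_contra hh; exact hn₂ (key3 _ _ hD₁ hD₂ hC₁ hC₂ hh)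
  have c12 := card_union_of_disjoint d12
  obtain ⟨D₃, hD₃, hC₃, h₃, hn₃⟩ := step (C ∩ D₁ ∪ C ∩ D₂) (by omega)
  have d13 : Disjoint (C ∩ D₁) (C ∩ D₃) := by
    by_contra hh
    exact hn₃ ((key3 _ _ hD₁ hD₃ hC₁ hC₃ hh).trans subset_union_left)
  have d23 : Disjoint (C ∩ D₂) (C ∩ D₃) := by
    by_contra hh
    exact hn₃ ((key3 _ _ hD₂ hD₃ hC₂ hC₃ hh).trans subset_union_right)
  have c123 := card_union_of_disjoint (disjoint_union_left.2 ⟨d13, d23⟩)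
  have := card_le_card (show (C ∩ D₁ ∪ C ∩ D₂) ∪ C ∩ D₃ ⊆ C from
    union_subset (union_subset inter_subset_left inter_subset_left) inter_subset_left)
  rw [hC.card_eq] at this
  omega

/-! ### Grids of cliques and rook's graphs -/

/-- The rook's graph on an `m × m` board. -/
def rookGraph (m : ℕ) : SimpleGraph (Fin m × Fin m) where
  Adj p q := p ≠ q ∧ (p.1 = q.1 ∨ p.2 = q.2)
  symm := ⟨fun _ _ h => ⟨h.1.symm, h.2.imp Eq.symm Eq.symm⟩⟩
  loopless := ⟨fun _ h => h.1 rfl⟩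

theorem nonempty_rookGraph_iso (m : ℕ) :
    Nonempty (rookGraph m ≃g (completeBipartiteGraph (Fin m) (Fin m)).lineGraph) := by
  let f : Fin m × Fin m → (completeBipartiteGraph (Fin m) (Fin m)).edgeSet := fun p =>
    ⟨s(Sum.inl p.1, Sum.inr p.2), by simp⟩
  have hf : Function.Bijective f := by
    constructor
    · rintro ⟨a, b⟩ ⟨c, d⟩ hab
      simpa [f] using hab
    · rintro ⟨e, he⟩
      induction e with
      | _ a b =>
        rcases a with a | a <;> rcases b with b | b <;> simp at he
        · exact ⟨(a, b), rfl⟩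
        · exact ⟨(b, a), by simp [f, Sym2.eq_swap]⟩
  refine ⟨Equiv.ofBijective f hf, ?_⟩
  rintro ⟨a, b⟩ ⟨c, d⟩
  simp only [Equiv.ofBijective_apply, lineGraph, rookGraph, hf.1.ne_iff]
  refine and_congr_right fun _ => ?_
  constructor
  · rintro ⟨x, hx, hx'⟩
    simp only [f, SetLike.mem_coe, Sym2.mem_iff] at hx hx'
    rcases hx with rfl | rfl <;> simp at hx' <;> simp [hx']
  · rintro (hh | hh)
    · exact ⟨Sum.inl a, by simp [f], by simp [f, hh]⟩
    · exact ⟨Sum.inr b, by simp [f], by simp [f, hh]⟩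

/-- If every element of `S` has at most one neighbour in a bigger set `A`, then some element of
`A` has no neighbour in `S`. -/
theorem exists_forall_not_adj {A S : Finset V} (hc : S.card < A.card)
    (h1 : ∀ s ∈ S, ∀ y ∈ A, ∀ y' ∈ A, G.Adj s y → G.Adj s y' → y = y') :
    ∃ y ∈ A, ∀ s ∈ S, ¬ G.Adj s y := by
  by_contra! hh
  choose! g hgS hg using hh
  obtain ⟨y, hy, y', hy', hne, he⟩ := exists_ne_map_eq_of_card_lt_of_maps_to hc hgS
  exact hne (h1 _ (hgS y hy) y hy y' hy' (hg y hy) (he ▸ hg y' hy'))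

/-- Two maximum cliques meet in at most one vertex, and every vertex lies in two of them. -/
structure GridData (G : SimpleGraph V) (m : ℕ) : Prop where
  inter : ∀ D E : Finset V, G.IsNClique m D → G.IsNClique m E →
    ∀ u v, u ≠ v → u ∈ D → u ∈ E → v ∈ D → v ∈ E → D = E
  other : ∀ (D : Finset V) (v : V), G.IsNClique m D → v ∈ D →
    ∃ E, G.IsNClique m E ∧ v ∈ E ∧ E ≠ D ∧ ∀ u, G.Adj v u → u ∈ D ∨ u ∈ E

namespace GridData

/-- The clique supplied by `other` must be `E`, since it shares a second vertex with it. -/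
theorem mem_or_mem (h : GridData G m) (hm : 2 ≤ m) {D E : Finset V} {v : V}
    (hD : G.IsNClique m D) (hE : G.IsNClique m E) (hvD : v ∈ D) (hvE : v ∈ E) (hne : D ≠ E)
    {u : V} (hu : G.Adj v u) : u ∈ D ∨ u ∈ E := by
  obtain ⟨F, hF, hvF, hFD, hFu⟩ := h.other D v hD hvD
  obtain ⟨w, hwE, hwv⟩ := exists_mem_ne (show 1 < E.card by rw [hE.card_eq]; omega) v
  have hwF : w ∈ F := (hFu w (hE.isClique hvE hwE hwv.symm)).resolve_left
    (fun hh => hne (h.inter D E hD hE w v hwv hh hwE hvD hvE))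
  rw [h.inter E F hE hF w v hwv hwE hwF hvE hvF]
  exact hFu u hu

/-- The second cliques `D c` at the vertices of a clique `C` are disjoint parallel lines, and the
second cliques `E r` at the vertices of `D c₁` are the transversal lines. The CIS property makes
every `D c` meet every `E r`, which yields the `m × m` cells. -/
theorem exists_iso (h : GridData G m) (hd : CISData G m k) (hG : G.Connected) (hm : 3 ≤ m) :
    Nonempty (G ≃g rookGraph m) := by
  classical
  have tri : ∀ {C : Finset V}, G.IsNClique m C → ∀ {u c c'}, c ∈ C → c' ∈ C → c ≠ c' →
      G.Adj u c → G.Adj u c' → u ∈ C := by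
    intro C hC u c c' hc hc' hne huc huc'
    have hadj := hC.isClique hc hc' hne
    obtain ⟨F, hsub, hF⟩ := hd.ext {u, c, c'} (by
      have := is3Clique_triple_iff.2 ⟨huc, huc', hadj⟩
      exact this.isClique)
    have := h.inter C F hC hF c c' hne hc (hsub (by simp)) hc' (hsub (by simp))
    exact this ▸ hsub (by simp)
  -- a family of second cliques through the vertices of `C` is disjoint
  have disj : ∀ {C : Finset V} {D : V → Finset V}, G.IsNClique m C →
      (∀ c ∈ C, G.IsNClique m (D c) ∧ c ∈ D c ∧ D c ≠ C) → ∀ {c c' u}, c ∈ C → c' ∈ C →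
      u ∈ D c → u ∈ D c' → c = c' := by
    intro C D hC hD c c' u hc hc' hu hu'
    by_contra hne
    obtain ⟨h1, h2, h3⟩ := hD c hc
    obtain ⟨h1', h2', h3'⟩ := hD c' hc'
    have e1 : u ≠ c := by
      rintro rfl
      exact h3' (h.inter _ _ h1' hC u c' hne hu' hc h2' hc')
    have e2 : u ≠ c' := by
      rintro rfl
      exact h3 (h.inter _ _ h1 hC u c (Ne.symm hne) hu hc' h2 hc)
    have huC := tri hC hc hc' hne (h1.isClique hu h2 e1) (h1'.isClique hu' h2' e2)
    exact h3 (h.inter _ _ h1 hC u c e1 hu huC h2 hc)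
  -- If `x` had no neighbour in `D c₂`, a stable set containing `x` and one vertex off `C` from each
  -- other `D c` would dominate `C`.
  have trans : ∀ {C : Finset V} {D : V → Finset V}, G.IsNClique m C →
      (∀ c ∈ C, G.IsNClique m (D c) ∧ c ∈ D c ∧ D c ≠ C) → ∀ {c₁ c₂ x}, c₁ ∈ C → c₂ ∈ C →
      c₁ ≠ c₂ → x ∈ D c₁ → x ≠ c₁ → ∃ y ∈ D c₂, G.Adj x y := by
    intro C D hC hD c₁ c₂ x hc₁ hc₂ hne hx hxc
    by_contra! hno
    have le1 : ∀ {c c' s}, c ∈ C → c' ∈ C → c ≠ c' → s ∈ D c → ∀ y ∈ D c', ∀ y' ∈ D c',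
        G.Adj s y → G.Adj s y' → y = y' := by
      intro c c' s hc hc' hcc hs y hy y' hy' hsy hsy'
      by_contra hyy
      have hsD := tri (hD c' hc').1 hy hy' hyy hsy hsy'
      exact hcc (disj hC hD hc hc' hs hsD)
    -- At each stage at most `m - 2` chosen vertices each exclude at most one of the `m - 1`
    -- candidates in `D t`.
    have greedy : ∀ T : Finset V, T ⊆ C → c₁ ∉ T → T.card + 2 ≤ m → ∃ S : Finset V,
        G.IsIndepSet (S : Set V) ∧ x ∈ S ∧ S.card ≤ T.card + 1 ∧
        (∀ s ∈ S, ∃ c ∈ insert c₁ T, s ∈ D c ∧ s ≠ c) ∧ ∀ c ∈ T, ∃ s ∈ S, s ∈ D c ∧ s ≠ c := by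
      intro T
      induction T using Finset.induction_on with
      | empty =>
        intro _ _ _
        exact ⟨{x}, by simp, by simp, by simp, by simp [hx, hxc], by simp⟩
      | insert t T htT ih =>
        intro hTC hcT hcard
        rw [card_insert_of_notMem htT] at hcard
        have htC : t ∈ C := hTC (mem_insert_self _ _)
        have htc : c₁ ≠ t := fun hh => hcT (hh ▸ mem_insert_self _ _)
        obtain ⟨S, hS, hxS, hSc, hS1, hS2⟩ := ih ((subset_insert _ _).trans hTC)
          (fun hh => hcT (mem_insert_of_mem hh)) (by omega)
        obtain ⟨hDt, htD, -⟩ := hD t htC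
        have hSt : ∀ s ∈ S, ∃ c ∈ C, c ≠ t ∧ s ∈ D c := by
          intro s hs
          obtain ⟨c, hc, hsc, -⟩ := hS1 s hs
          rw [mem_insert] at hc
          rcases hc with rfl | hc
          · exact ⟨c, hc₁, htc, hsc⟩
          · exact ⟨c, hTC (mem_insert_of_mem hc), fun hh => htT (hh ▸ hc), hsc⟩
        obtain ⟨y, hy, hyS⟩ := exists_forall_not_adj (G := G) (A := (D t).erase t) (S := S)
          (by rw [card_erase_of_mem htD, hDt.card_eq]; omega) (by
            intro s hs y hy y' hy'
            obtain ⟨c, hc, hct, hsc⟩ := hSt s hs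
            exact le1 hc htC hct hsc y (mem_of_mem_erase hy) y' (mem_of_mem_erase hy'))
        rw [mem_erase] at hy
        refine ⟨insert y S, ?_, mem_insert_of_mem hxS, ?_, ?_, ?_⟩
        · rw [← isClique_compl, coe_insert, isClique_insert, isClique_compl]
          refine ⟨hS, fun b hb hyb => ?_⟩
          rw [compl_adj]
          exact ⟨hyb, fun hh => hyS b hb hh.symm⟩
        · rw [card_insert_of_notMem htT]
          exact (card_insert_le _ _).trans (by omega)
        · intro s hs
          rw [mem_insert] at hs
          rcases hs with rfl | hs
          · exact ⟨t, by simp, hy.2, hy.1⟩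
          · obtain ⟨c, hc, hh⟩ := hS1 s hs
            exact ⟨c, insert_subset_insert _ (subset_insert _ _) hc, hh⟩
        · intro c hc
          rw [mem_insert] at hc
          rcases hc with rfl | hc
          · exact ⟨y, mem_insert_self _ _, hy.2, hy.1⟩
          · obtain ⟨s, hs, hh⟩ := hS2 c hc
            exact ⟨s, mem_insert_of_mem hs, hh⟩
    have hc₂' : c₂ ∈ C.erase c₁ := mem_erase.2 ⟨hne.symm, hc₂⟩
    have hcT : ((C.erase c₁).erase c₂).card + 2 = m := by
      rw [card_erase_of_mem hc₂', card_erase_of_mem hc₁, hC.card_eq]; omega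
    obtain ⟨S, hS, hxS, hSc, hS1, hS2⟩ := greedy ((C.erase c₁).erase c₂)
      ((erase_subset _ _).trans (erase_subset _ _)) (by simp) hcT.le
    obtain ⟨hD2, h2D, -⟩ := hD c₂ hc₂
    -- `S` may have `m - 1` elements, as many as there are candidates, but `x` excludes none of
    -- them.
    obtain ⟨y, hy, hyS⟩ := exists_forall_not_adj (G := G) (A := (D c₂).erase c₂) (S := S.erase x)
      (by rw [card_erase_of_mem h2D, hD2.card_eq, card_erase_of_mem hxS]; omega) (by
        intro s hs y hy y' hy'
        obtain ⟨c, hc, hsc, -⟩ := hS1 s (mem_of_mem_erase hs)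
        have hcC : c ∈ C ∧ c ≠ c₂ := by
          simp only [mem_insert, mem_erase] at hc
          rcases hc with rfl | hc
          · exact ⟨hc₁, hne⟩
          · exact ⟨hc.2.2, hc.1⟩
        exact le1 hcC.1 hc₂ hcC.2 hsc y (mem_of_mem_erase hy) y' (mem_of_mem_erase hy'))
    rw [mem_erase] at hy
    have hyS' : ∀ s ∈ S, ¬ G.Adj s y := by
      intro s hs
      by_cases hsx : s = x
      · exact hsx ▸ hno y hy.2
      · exact hyS s (mem_erase.2 ⟨hsx, hs⟩)
    obtain ⟨c, hcC, hcS⟩ := hd.cis C hC (insert y S) (by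
      rw [← isClique_compl, coe_insert, isClique_insert, isClique_compl]
      refine ⟨hS, fun b hb hyb => ?_⟩
      rw [compl_adj]
      exact ⟨hyb, fun hh => hyS' b hb hh.symm⟩)
    have hcadj : ∀ s ∈ insert y S, s ∈ D c → s ≠ c → False := fun s hs hsD hsc =>
      hcS s hs ((hD c hcC).1.isClique (hD c hcC).2.1 hsD hsc.symm)
    by_cases e1 : c = c₁
    · subst e1; exact hcadj x (mem_insert_of_mem hxS) hx hxc
    by_cases e2 : c = c₂
    · subst e2; exact hcadj y (mem_insert_self _ _) hy.2 hy.1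
    obtain ⟨s, hs, hsD, hsc⟩ := hS2 c (by simp [e1, e2, hcC])
    exact hcadj s (mem_insert_of_mem hs) hsD hsc
  obtain ⟨C, hC⟩ := hd.exists_nclique
  obtain ⟨c₁, hc₁⟩ := card_pos.1 (show 0 < C.card by rw [hC.card_eq]; omega)
  have hex : ∀ B : Finset V, G.IsNClique m B → ∃ D : V → Finset V,
      ∀ c ∈ B, G.IsNClique m (D c) ∧ c ∈ D c ∧ D c ≠ B := by
    intro B hB
    have : ∀ c, ∃ E : Finset V, c ∈ B → G.IsNClique m E ∧ c ∈ E ∧ E ≠ B := by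
      intro c
      by_cases hc : c ∈ B
      · obtain ⟨E, hE, hcE, hne, -⟩ := h.other B c hB hc
        exact ⟨E, fun _ => ⟨hE, hcE, hne⟩⟩
      · exact ⟨∅, fun hh => absurd hh hc⟩
    choose D hD using this
    exact ⟨D, hD⟩
  obtain ⟨D, hD⟩ := hex C hC
  obtain ⟨hD1, h1D, hDC⟩ := hD c₁ hc₁
  obtain ⟨E, hE⟩ := hex (D c₁) hD1
  have hcell : ∀ c ∈ C, ∀ r ∈ D c₁, ∃ v, v ∈ D c ∧ v ∈ E r := by
    intro c hc r hr
    obtain ⟨hEr, hrE, hne⟩ := hE r hr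
    -- The transversal line through `c₁` is `C` itself.
    by_cases e1 : r = c₁
    · subst e1
      refine ⟨c, (hD c hc).2.1, ?_⟩
      obtain ⟨w, hwC, hwr⟩ := exists_mem_ne (show 1 < C.card by rw [hC.card_eq]; omega) r
      have hwE := (h.mem_or_mem (by omega) hD1 hEr hr hrE hne.symm
        (hC.isClique hc₁ hwC hwr.symm)).resolve_left
          (fun hh => hDC (h.inter _ _ hD1 hC w r hwr hh hwC hr hc₁))
      rwa [h.inter _ _ hEr hC w r hwr hwE hwC hrE hc₁]
    by_cases e2 : c = c₁
    · subst e2; exact ⟨r, hr, hrE⟩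
    obtain ⟨y, hy, hry⟩ := trans hC hD hc₁ hc (Ne.symm e2) hr e1
    refine ⟨y, hy, (h.mem_or_mem (by omega) hD1 hEr hr hrE hne.symm hry).resolve_left
      (fun hh => e2 (disj hC hD hc hc₁ hy hh))⟩
  let a : Fin m ≃ C := (C.equivFinOfCardEq hC.card_eq).symm
  let b : Fin m ≃ D c₁ := ((D c₁).equivFinOfCardEq hD1.card_eq).symm
  choose f hfD hfE using fun p : Fin m × Fin m => hcell (a p.1) (a p.1).2 (b p.2) (b p.2).2
  have hrow : ∀ p q : Fin m × Fin m, f q ∈ D (a p.1) → p.1 = q.1 := fun p q hq =>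
    a.injective (Subtype.ext (disj hC hD (a p.1).2 (a q.1).2 hq (hfD q)))
  have hcol : ∀ p q : Fin m × Fin m, f q ∈ E (b p.2) → p.2 = q.2 := fun p q hq =>
    b.injective (Subtype.ext (disj hD1 hE (b p.2).2 (b q.2).2 hq (hfE q)))
  have hinj : Function.Injective f := fun p q hpq =>
    Prod.ext (hrow p q (hpq ▸ hfD p)) (hcol p q (hpq ▸ hfE p))
  have hsurj : ∀ (g : Fin m → V) (B : Finset V), Function.Injective g → B.card = m →
      (∀ i, g i ∈ B) → ∀ v ∈ B, ∃ i, g i = v := by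
    intro g B hg hB hgB v hv
    have : univ.image g = B := eq_of_subset_of_card_le
      (by intro x hx; obtain ⟨i, -, rfl⟩ := mem_image.1 hx; exact hgB i)
      (by rw [card_image_of_injective _ hg, card_univ, Fintype.card_fin, hB])
    rw [← this, mem_image] at hv
    obtain ⟨i, -, hi⟩ := hv
    exact ⟨i, hi⟩
  have : Nonempty (Fin m × Fin m) := ⟨⟨⟨0, by omega⟩, ⟨0, by omega⟩⟩⟩
  refine hG.nonempty_iso_of_closed f hinj ?_ ?_
  · rintro p q ⟨hne, hpq | hpq⟩
    · exact (hD _ (a p.1).2).1.isClique (hfD p) (hpq ▸ hfD q) (hinj.ne hne)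
    · exact (hE _ (b p.2).2).1.isClique (hfE p) (hpq ▸ hfE q) (hinj.ne hne)
  · intro p v hv
    have hDp := hD _ (a p.1).2
    have hEp := hE _ (b p.2).2
    have hne : D (a p.1) ≠ E (b p.2) := by
      intro hh
      by_cases e : (a p.1 : V) = c₁
      · exact hEp.2.2 (by rw [← hh, e])
      · exact e (disj hC hD (a p.1).2 hc₁ (hh ▸ hEp.2.1) (b p.2).2)
    rcases h.mem_or_mem (by omega) hDp.1 hEp.1 (hfD p) (hfE p) hne hv with hv' | hv'
    · obtain ⟨j, hj⟩ := hsurj (fun j => f (p.1, j)) (D (a p.1))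
        (fun j j' hjj => congrArg Prod.snd (hinj hjj)) hDp.1.card_eq (fun j => hfD (p.1, j)) v hv'
      refine ⟨(p.1, j), ⟨fun hh => ?_, Or.inl rfl⟩, hj⟩
      exact hv.ne (by rw [hh, ← hj])
    · obtain ⟨i, hi⟩ := hsurj (fun i => f (i, p.2)) (E (b p.2))
        (fun j j' hjj => congrArg Prod.fst (hinj hjj)) hEp.1.card_eq (fun i => hfE (i, p.2)) v hv'
      refine ⟨(i, p.2), ⟨fun hh => ?_, Or.inr rfl⟩, hi⟩
      exact hv.ne (by rw [hh, ← hi])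

end GridData

namespace CISData

theorem exists_rest [DecidableEq V] (h : CISData G m k) {v : V} {L : Finset V}
    (hL : ∀ u ∈ L, G.Adj v u) :
    ∃ R : Finset V, R.card + L.card = k ∧ ∀ u, u ∈ R ↔ G.Adj v u ∧ u ∉ L := by
  obtain ⟨N, hN, hNv⟩ := h.reg v
  have hsub : L ⊆ N := fun x hx => (hNv x).2 (hL x hx)
  exact ⟨N \ L, by rw [card_sdiff_add_card_eq_card hsub, hN], fun u => by rw [mem_sdiff, hNv]⟩

/-! ### Cliques of size three -/

section Three

variable (h : CISData G 3 k)
include h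

theorem tri_unique {a b c d : V} (hab : G.Adj a b) (hac : G.Adj a c) (hbc : G.Adj b c)
    (had : G.Adj a d) (hbd : G.Adj b d) : c = d := by
  classical
  by_contra hne
  have := h.near (is3Clique_triple_iff.2 ⟨hab, hac, hbc⟩) (u := d) (T := {a, b})
    (by simp [had.ne', hbd.ne', Ne.symm hne]) (by grind) (by
      simp [had.symm, hbd.symm])
  rw [card_pair hab.ne] at this
  omega

theorem exists_tri {a b : V} (hab : G.Adj a b) : ∃ c, G.Adj a c ∧ G.Adj b c := by
  classical
  obtain ⟨t, ht, hC⟩ := h.ext {a, b} (by simp [hab])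
  obtain ⟨c, hc, hcn⟩ := exists_mem_notMem_of_card_lt_card (s := {a, b}) (t := t)
    (by rw [card_pair hab.ne, hC.card_eq]; norm_num)
  rw [mem_insert, mem_singleton, not_or] at hcn
  exact ⟨c, hC.isClique (ht (by simp)) hc (Ne.symm hcn.1),
    hC.isClique (ht (by simp)) hc (Ne.symm hcn.2)⟩

theorem not_stable_three {a b c x y z : V} (hab : G.Adj a b) (hac : G.Adj a c)
    (hbc : G.Adj b c) (hx : G.Adj a x) (hy : G.Adj b y) (hz : G.Adj c z)
    (hxy : ¬ G.Adj x y) (hxz : ¬ G.Adj x z) (hyz : ¬ G.Adj y z) : False := by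
  classical
  obtain ⟨c, hc, hcS⟩ := h.cis {a, b, c} (is3Clique_triple_iff.2 ⟨hab, hac, hbc⟩) {x, y, z} (by
    intro p hp q hq _
    simp only [coe_insert, coe_singleton, Set.mem_insert_iff, Set.mem_singleton_iff] at hp hq
    rcases hp with rfl | rfl | rfl <;> rcases hq with rfl | rfl | rfl <;>
      first
      | exact G.irrefl
      | assumption
      | (rw [G.adj_comm]; assumption))
  simp only [mem_insert, mem_singleton] at hc
  rcases hc with rfl | rfl | rfl
  · exact hcS x (by simp) hx
  · exact hcS y (by simp) hy
  · exact hcS z (by simp) hz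

/-- Sending a neighbour of `v` to the third vertex of the triangle on that edge is a
fixed-point-free involution of the neighbourhood, which is counted modulo 2. -/
theorem even_of_three : Even k := by
  classical
  choose! g hg1 hg2 using fun a b (hab : G.Adj a b) => h.exists_tri hab
  obtain ⟨C, hC⟩ := h.exists_nclique
  obtain ⟨v, hv⟩ := card_pos.1 (show 0 < C.card by rw [hC.card_eq]; omega)
  obtain ⟨N, hN, hNv⟩ := h.reg v
  rw [← hN, ← ZMod.natCast_eq_zero_iff_even, ← nsmul_one, ← sum_const]
  refine sum_involution (fun a _ => g v a) (fun _ _ => by decide) ?_ ?_ ?_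
  · intro a ha _
    exact (hg2 v a ((hNv a).1 ha)).ne'
  · intro a ha
    exact (hNv _).2 (hg1 v a ((hNv a).1 ha))
  · intro a ha
    rw [hNv] at ha
    have h1 := hg1 v a ha
    have h2 := hg2 v a ha
    exact (h.tri_unique h1 ha h2.symm (hg1 _ _ h1) (hg2 _ _ h1)).symm

end Three

theorem gridData_three (h : CISData G 3 4) : GridData G 3 := by
  classical
  constructor
  · intro D E hD hE u v huv h1 h2 h3 h4
    by_contra hne
    have := h.card_inter hD hE hne
    have := card_le_card (show {u, v} ⊆ D ∩ E by grind)
    rw [card_pair huv] at this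
    omega
  · intro D v hD hv
    obtain ⟨R, hR, hRv⟩ := h.exists_rest (v := v) (L := D.erase v) (fun u hu =>
      hD.isClique hv (mem_of_mem_erase hu) (ne_of_mem_erase hu).symm)
    rw [card_erase_of_mem hv, hD.card_eq] at hR
    obtain ⟨p, q, hpq, rfl⟩ := card_eq_two.1 (show R.card = 2 by omega)
    have hp := (hRv p).1 (by simp)
    have hq := (hRv q).1 (by simp)
    obtain ⟨x, hvx, hpx⟩ := h.exists_tri hp.1
    have hxD : x ∉ D.erase v := by
      intro hx
      rw [mem_erase] at hx
      have := h.near hD (u := p) (T := {v, x}) (fun hh => hp.2 (mem_erase.2 ⟨hp.1.ne', hh⟩))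
        (by grind) (by simp [hpx, hp.1.symm])
      rw [card_pair hvx.ne] at this
      omega
    have hxq : x = q := by
      have := (hRv x).2 ⟨hvx, hxD⟩
      rw [mem_insert, mem_singleton] at this
      exact this.resolve_left hpx.ne'
    subst hxq
    refine ⟨{v, p, x}, is3Clique_triple_iff.2 ⟨hp.1, hvx, hpx⟩, by simp, ?_, ?_⟩
    · rintro rfl
      exact hp.2 (mem_erase.2 ⟨hp.1.ne', by simp⟩)
    · intro u hu
      by_cases huD : u ∈ D
      · exact Or.inl huD
      · have := (hRv u).2 ⟨hu, fun hh => huD (mem_of_mem_erase hh)⟩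
        right
        simp only [mem_insert, mem_singleton] at this ⊢
        exact Or.inr this

/-- The four outer neighbours of each vertex of a triangle `abc` form two adjacent pairs. An outer
neighbour `x` of `a` sees exactly one vertex of each pair at `b` and at `c`. If `y` is its neighbour
in a pair at `b`, then `y` is adjacent to the neighbours of `x` in both pairs at `c`, so `xy` lies
in two triangles. -/
theorem false_of_three_six (h : CISData G 3 6) : False := by
  classical
  obtain ⟨C, hC⟩ := h.exists_nclique
  obtain ⟨a, b, c, hab, hac, hbc, -⟩ := is3Clique_iff.1 hC
  have pairs : ∀ {a b c}, G.Adj a b → G.Adj a c → G.Adj b c → ∃ x x' y y', G.Adj a x ∧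
      G.Adj a x' ∧ G.Adj a y ∧ G.Adj a y' ∧ G.Adj x x' ∧ G.Adj y y' ∧ x ≠ y ∧ x ≠ y' ∧
      x ≠ b ∧ x ≠ c ∧ x' ≠ b ∧ x' ≠ c ∧ y ≠ b ∧ y ≠ c ∧ y' ≠ b ∧ y' ≠ c := by
    intro a b c hab hac hbc
    obtain ⟨R, hR, hRa⟩ := h.exists_rest (v := a) (L := {b, c}) (by simp [hab, hac])
    rw [card_pair hbc.ne] at hR
    have stepR : ∀ u ∈ R, ∃ u' ∈ R, G.Adj u u' := by
      intro u hu
      have hu' := (hRa u).1 hu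
      obtain ⟨w, haw, huw⟩ := h.exists_tri hu'.1
      refine ⟨w, (hRa w).2 ⟨haw, ?_⟩, huw⟩
      intro hw
      simp only [mem_insert, mem_singleton] at hw
      apply hu'.2
      rcases hw with rfl | rfl
      · simp [h.tri_unique haw hac hbc hu'.1 huw.symm]
      · simp [h.tri_unique haw hab hbc.symm hu'.1 huw.symm]
    obtain ⟨x, hx⟩ := card_pos.1 (show 0 < R.card by omega)
    obtain ⟨x', hx', hxx⟩ := stepR x hx
    obtain ⟨y, hy, hyn⟩ := exists_mem_notMem_of_card_lt_card (s := {x, x'}) (t := R)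
      (by rw [card_pair hxx.ne]; omega)
    obtain ⟨y', hy', hyy⟩ := stepR y hy
    simp only [mem_insert, mem_singleton, not_or] at hyn
    have e : x ≠ y' := by
      rintro rfl
      exact hyn.2 (h.tri_unique ((hRa _).1 hx).1 ((hRa _).1 hx').1 hxx ((hRa _).1 hy).1
        hyy.symm).symm
    simp only [hRa, mem_insert, mem_singleton, not_or] at hx hx' hy hy'
    exact ⟨x, x', y, y', hx.1, hx'.1, hy.1, hy'.1, hxx, hyy, Ne.symm hyn.1, e, hx.2.1, hx.2.2,
      hx'.2.1, hx'.2.2, hy.2.1, hy.2.2, hy'.2.1, hy'.2.2⟩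
  -- an outer neighbour of `a` is adjacent to at least one vertex of each pair at `b`
  have one : ∀ {a b c x y y' z z'}, G.Adj a b → G.Adj a c → G.Adj b c → G.Adj a x →
      x ≠ b → x ≠ c → G.Adj b y → G.Adj b y' → G.Adj y y' → G.Adj c z → G.Adj c z' →
      G.Adj z z' → z ≠ a → z ≠ b → z' ≠ a → z' ≠ b → ¬ G.Adj x y → G.Adj x y' := by
    intro a b c x y y' z z' hab hac hbc hax hxb hxc hby hby' hyy hcz hcz' hzz hza hzb hza' hzb'
      hxy
    by_contra hxy'
    -- Neither `{x, y, z}` nor `{x, y', z}` may be stable, so `z` completes `yy'` to a second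
    -- triangle besides that with `b`. One of `z`, `z'` always misses `x`.
    have main : ∀ z, G.Adj c z → z ≠ b → ¬ G.Adj x z → False := by
      intro z hcz hzb hxz
      have h1 : G.Adj y z := by
        by_contra hh
        exact h.not_stable_three hab hac hbc hax hby hcz hxy hxz hh
      have h2 : G.Adj y' z := by
        by_contra hh
        exact h.not_stable_three hab hac hbc hax hby' hcz hxy' hxz hh
      exact hzb (h.tri_unique hyy hby.symm hby'.symm h1 h2).symm
    by_cases hxz : G.Adj x z
    · refine main z' hcz' hzb' fun hxz' => ?_
      have := h.tri_unique hzz hcz.symm hcz'.symm hxz.symm hxz'.symm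
      exact hxc this.symm
    · exact main z hcz hzb hxz
  obtain ⟨x, -, -, -, hax, -, -, -, -, -, -, -, hxb, hxc, -⟩ := pairs hab hac hbc
  obtain ⟨y, y', -, -, hby, hby', -, -, hyy, -, -, -, hya, hyc, hya', hyc', -⟩ :=
    pairs hab.symm hbc hac
  obtain ⟨z, z', w, w', hcz, hcz', hcw, hcw', hzz, hww, hzw, hzw', hza, hzb, hza', hzb', hwa, hwb,
    hwa', hwb'⟩ := pairs hac.symm hbc.symm hab
  have hzw'' : z' ≠ w := by
    rintro rfl
    exact hzw' (h.tri_unique hcz' hcz hzz.symm hcw' hww)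
  have hzw''' : z' ≠ w' := by
    rintro rfl
    exact hzw (h.tri_unique hcz' hcz hzz.symm hcw hww.symm)
  have fin : ∀ {y y'}, G.Adj b y → G.Adj b y' → G.Adj y y' → y ≠ a → y ≠ c → y' ≠ a → y' ≠ c →
      G.Adj x y → False := by
    intro y y' hby hby' hyy hya hyc hya' hyc' hxy
    have hxy' : ¬ G.Adj x y' := fun hh =>
      hxb (h.tri_unique hyy hby.symm hby'.symm hxy.symm hh.symm).symm
    -- Stability of `{x, y', z'}` is excluded, so `y'` sees `z'` and `y` does not; then `one`,
    -- applied to `y`, gives `z`. The pair it needs at `a` is `x` with the third vertex of a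
    -- triangle on `ax`.
    have tail : ∀ {z z'}, G.Adj c z → G.Adj c z' → G.Adj z z' → z ≠ a → z ≠ b → z' ≠ a →
        z' ≠ b → G.Adj x z → G.Adj y z := by
      intro z z' hcz hcz' hzz hza hzb hza' hzb' hxz
      have hxz' : ¬ G.Adj x z' := fun hh =>
        hxc (h.tri_unique hzz hcz.symm hcz'.symm hxz.symm hh.symm).symm
      have h1 : G.Adj y' z' := by
        by_contra hh
        exact h.not_stable_three hab hac hbc hax hby' hcz' hxy' hxz' hh
      have h2 : ¬ G.Adj y z' := fun hh =>
        hzb' (h.tri_unique hyy hby.symm hby'.symm hh h1).symm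
      exact one hbc hab.symm hac.symm hby hyc hya hcz' hcz hzz.symm hax
        (h.exists_tri hax).choose_spec.1 (h.exists_tri hax).choose_spec.2 hxb hxc
        (fun hh => by
          have := (h.exists_tri hax).choose_spec
          rw [hh] at this
          exact hxc (h.tri_unique hab hac hbc hax this.2.symm).symm)
        (fun hh => by
          have := (h.exists_tri hax).choose_spec
          rw [hh] at this
          exact hxb (h.tri_unique hac hab hbc.symm hax this.2.symm).symm) h2
    have two : ∀ {z w}, z ≠ w → G.Adj x z → G.Adj x w → G.Adj y z → G.Adj y w → False :=
      fun hzw h1 h2 h3 h4 => hzw (h.tri_unique hxy h1 h3 h2 h4)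
    by_cases hxz : G.Adj x z
    · have t1 := tail hcz hcz' hzz hza hzb hza' hzb' hxz
      by_cases hxw : G.Adj x w
      · exact two hzw hxz hxw t1 (tail hcw hcw' hww hwa hwb hwa' hwb' hxw)
      · have hxw' := one hac hab hbc.symm hax hxc hxb hcw hcw' hww hby hby' hyy hya hyc hya'
          hyc' hxw
        exact two hzw' hxz hxw' t1 (tail hcw' hcw hww.symm hwa' hwb' hwa hwb hxw')
    · have hxz' := one hac hab hbc.symm hax hxc hxb hcz hcz' hzz hby hby' hyy hya hyc hya'
          hyc' hxz
      have t1 := tail hcz' hcz hzz.symm hza' hzb' hza hzb hxz'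
      by_cases hxw : G.Adj x w
      · exact two hzw'' hxz' hxw t1 (tail hcw hcw' hww hwa hwb hwa' hwb' hxw)
      · have hxw' := one hac hab hbc.symm hax hxc hxb hcw hcw' hww hby hby' hyy hya hyc hya'
          hyc' hxw
        exact two hzw''' hxz' hxw' t1 (tail hcw' hcw hww.symm hwa' hwb' hwa hwb hxw')
  by_cases hxy : G.Adj x y
  · exact fin hby hby' hyy hya hyc hya' hyc' hxy
  · exact fin hby' hby hyy.symm hya' hyc' hya hyc
      (one hab hac hbc hax hxb hxc hby hby' hyy hcz hcz' hzz hza hzb hza' hzb' hxy)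

end CISData

/-! ### Cliques of size four: general tools and valencies five and six -/

/-- `a, b, c, d` are pairwise adjacent. -/
def K4 (G : SimpleGraph V) (a b c d : V) : Prop :=
  G.Adj a b ∧ G.Adj a c ∧ G.Adj a d ∧ G.Adj b c ∧ G.Adj b d ∧ G.Adj c d

theorem K4.swap12 {a b c d : V} (h : G.K4 a b c d) : G.K4 b a c d := by
  obtain ⟨h1, h2, h3, h4, h5, h6⟩ := h
  exact ⟨h1.symm, h4, h5, h2, h3, h6⟩

theorem K4.swap23 {a b c d : V} (h : G.K4 a b c d) : G.K4 a c b d := by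
  obtain ⟨h1, h2, h3, h4, h5, h6⟩ := h
  exact ⟨h2, h1, h3, h4.symm, h6, h5⟩

theorem K4.swap34 {a b c d : V} (h : G.K4 a b c d) : G.K4 a b d c := by
  obtain ⟨h1, h2, h3, h4, h5, h6⟩ := h
  exact ⟨h1, h3, h2, h5, h4, h6.symm⟩

theorem K4.rot {a b c d : V} (h : G.K4 a b c d) : G.K4 b c d a :=
  h.swap12.swap23.swap34

theorem K4.pairs {a b c d : V} (h : G.K4 a b c d) : G.K4 c d a b := h.rot.rot

theorem K4.isNClique [DecidableEq V] {a b c d : V} (h : G.K4 a b c d) :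
    G.IsNClique 4 {a, b, c, d} := by
  obtain ⟨h1, h2, h3, h4, h5, h6⟩ := h
  exact (is3Clique_triple_iff.2 ⟨h4, h5, h6⟩).insert (by simp [h1, h2, h3])

theorem IsNClique.exists_K4 [DecidableEq V] {C : Finset V} (hC : G.IsNClique 4 C) {a : V}
    (ha : a ∈ C) : ∃ b c d, G.K4 a b c d ∧ C = {a, b, c, d} := by
  obtain ⟨b, c, d, hbc, hbd, hcd, he⟩ := card_eq_three.1
    (show (C.erase a).card = 3 by rw [card_erase_of_mem ha, hC.card_eq])
  have hmem : ∀ x, x ∈ ({b, c, d} : Finset V) → x ∈ C ∧ a ≠ x := fun x hx => by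
    rw [← he, mem_erase] at hx
    exact ⟨hx.2, hx.1.symm⟩
  have hb := hmem b (by simp)
  have hc := hmem c (by simp)
  have hd := hmem d (by simp)
  refine ⟨b, c, d, ⟨hC.isClique ha hb.1 hb.2, hC.isClique ha hc.1 hc.2, hC.isClique ha hd.1 hd.2,
    hC.isClique hb.1 hc.1 hbc, hC.isClique hb.1 hd.1 hbd, hC.isClique hc.1 hd.1 hcd⟩, ?_⟩
  rw [← he, insert_erase ha]

instance lexProduct.decidableAdj {W X : Type*} [DecidableEq W] (A : SimpleGraph W)
    (B : SimpleGraph X) [DecidableRel A.Adj] [DecidableRel B.Adj] :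
    DecidableRel (A.lexProduct B).Adj :=
  fun _ _ => inferInstanceAs (Decidable (_ ∨ _))

namespace CISData

section Four

variable (h : CISData G 4 k)
include h

theorem near4 {a b c d u : V} (hK : G.K4 a b c d) (ha : G.Adj a u) (hb : G.Adj b u)
    (hc : G.Adj c u) : u = d := by
  classical
  by_contra hne
  have := h.near hK.isNClique (u := u) (T := {a, b, c})
    (by simp [ha.ne', hb.ne', hc.ne', hne]) (by grind) (by simp [ha.symm, hb.symm, hc.symm])
  rw [card_eq_three.2 ⟨a, b, c, hK.1.ne, hK.2.1.ne, hK.2.2.2.1.ne, rfl⟩] at this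
  omega

theorem tri4 {a b c : V} (hab : G.Adj a b) (hac : G.Adj a c) (hbc : G.Adj b c) :
    ∃ d, G.K4 a b c d := by
  classical
  have h3 := is3Clique_triple_iff.2 ⟨hab, hac, hbc⟩
  obtain ⟨t, ht, hC⟩ := h.ext {a, b, c} h3.isClique
  obtain ⟨d, hd, hdn⟩ := exists_mem_notMem_of_card_lt_card (s := {a, b, c}) (t := t)
    (by rw [h3.card_eq, hC.card_eq]; norm_num)
  simp only [mem_insert, mem_singleton, not_or] at hdn
  exact ⟨d, hab, hac, hC.isClique (ht (by simp)) hd (Ne.symm hdn.1), hbc,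
    hC.isClique (ht (by simp)) hd (Ne.symm hdn.2.1),
    hC.isClique (ht (by simp)) hd (Ne.symm hdn.2.2)⟩

theorem edge4 {a b : V} (hab : G.Adj a b) : ∃ c d, G.K4 a b c d := by
  classical
  obtain ⟨t, ht, hC⟩ := h.ext {a, b} (by simp [hab])
  obtain ⟨c, hc, hcn⟩ := exists_mem_notMem_of_card_lt_card (s := {a, b}) (t := t)
    (by rw [card_pair hab.ne, hC.card_eq]; norm_num)
  simp only [mem_insert, mem_singleton, not_or] at hcn
  exact ⟨c, h.tri4 hab (hC.isClique (ht (by simp)) hc (Ne.symm hcn.1))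
    (hC.isClique (ht (by simp)) hc (Ne.symm hcn.2))⟩

/-- Otherwise `{u, w}` would be a stable set dominating the clique. This produces the complete joins
between pairs in all cases below except the grid. -/
theorem cover2 {a b c d u w : V} (hK : G.K4 a b c d) (ha : G.Adj a u) (hb : G.Adj b u)
    (hc : G.Adj c w) (hd : G.Adj d w) : G.Adj u w := by
  classical
  by_contra hne
  obtain ⟨x, hx, hxS⟩ := h.cis _ hK.isNClique {u, w} (by
    intro p hp q hq _
    simp only [coe_insert, coe_singleton, Set.mem_insert_iff, Set.mem_singleton_iff] at hp hq
    rcases hp with rfl | rfl <;> rcases hq with rfl | rfl <;> first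
      | exact G.irrefl
      | assumption
      | (rw [G.adj_comm]; assumption))
  simp only [mem_insert, mem_singleton] at hx
  rcases hx with rfl | rfl | rfl | rfl
  · exact hxS u (by simp) ha
  · exact hxS u (by simp) hb
  · exact hxS w (by simp) hc
  · exact hxS w (by simp) hd

theorem exists_rest4 [DecidableEq V] {v x y z : V} (hK : G.K4 v x y z) :
    ∃ R : Finset V, R.card + 3 = k ∧ ∀ u, u ∈ R ↔ G.Adj v u ∧ u ≠ x ∧ u ≠ y ∧ u ≠ z := by
  obtain ⟨h1, h2, h3, h4, h5, h6⟩ := hK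
  obtain ⟨R, hR, hRv⟩ := h.exists_rest (v := v) (L := {x, y, z}) (by simp [h1, h2, h3])
  rw [card_eq_three.2 ⟨x, y, z, h4.ne, h5.ne, h6.ne, rfl⟩] at hR
  exact ⟨R, hR, fun u => by simp [hRv]⟩

theorem exists_vertex : Nonempty V := by
  obtain ⟨C, hC⟩ := h.exists_nclique
  obtain ⟨v, -⟩ := card_pos.1 (show 0 < C.card by rw [hC.card_eq]; omega)
  exact ⟨v⟩

/-- A third clique at `v` cannot consist of `v`, a new vertex and two vertices of two cliques
through the edge `vc`. -/
theorem false_of_cross {v c a b p q r s t : V} (h1 : G.K4 v c a b) (h2 : G.K4 v c p q)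
    (hpa : p ≠ a) (hpb : p ≠ b) (hqa : q ≠ a) (hqb : q ≠ b)
    (hr : G.Adj v r ∧ r ≠ c ∧ r ≠ a ∧ r ≠ b ∧ r ≠ p ∧ r ≠ q) (hst : G.K4 v r s t)
    (hs' : s = c ∨ s = a ∨ s = b ∨ s = p ∨ s = q) (ht' : t = c ∨ t = a ∨ t = b ∨ t = p ∨ t = q) :
    False := by
  obtain ⟨b1, b2, b3, b4, b5, b6⟩ := id h2
  obtain ⟨d1, d2, d3, d4, d5, d6⟩ := id hst
  have nca : ¬ (G.Adj r c ∧ G.Adj r a) := fun hh =>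
    hr.2.2.2.1 (h.near4 h1 hr.1 hh.1.symm hh.2.symm)
  have ncb : ¬ (G.Adj r c ∧ G.Adj r b) := fun hh =>
    hr.2.2.1 (h.near4 h1.swap34 hr.1 hh.1.symm hh.2.symm)
  have nab : ¬ (G.Adj r a ∧ G.Adj r b) := fun hh =>
    hr.2.1 (h.near4 h1.swap23.swap34 hr.1 hh.1.symm hh.2.symm)
  have ncp : ¬ (G.Adj r c ∧ G.Adj r p) := fun hh =>
    hr.2.2.2.2.2 (h.near4 h2 hr.1 hh.1.symm hh.2.symm)
  have ncq : ¬ (G.Adj r c ∧ G.Adj r q) := fun hh =>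
    hr.2.2.2.2.1 (h.near4 h2.swap34 hr.1 hh.1.symm hh.2.symm)
  have npq : ¬ (G.Adj r p ∧ G.Adj r q) := fun hh =>
    hr.2.1 (h.near4 h2.swap23.swap34 hr.1 hh.1.symm hh.2.symm)
  have map_ : ¬ G.Adj a p := fun hh => hpb (h.near4 h1 b2 b4 hh)
  have maq : ¬ G.Adj a q := fun hh => hqb (h.near4 h1 b3 b5 hh)
  have mbp : ¬ G.Adj b p := fun hh => hpa (h.near4 h1.swap34 b2 b4 hh)
  have mbq : ¬ G.Adj b q := fun hh => hqa (h.near4 h1.swap34 b3 b5 hh)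
  have := d6.symm
  clear h1 h2 hst b1 b2 b3 b4 b5 b6
  rcases hs' with rfl | rfl | rfl | rfl | rfl <;> rcases ht' with rfl | rfl | rfl | rfl | rfl <;>
    simp_all

end Four

/-- The outer neighbour `p` sees at most one of `x, y, z`, so the clique through `vp` must use one
of these and the other outer neighbour `q`. -/
theorem exists_double_five (h : CISData G 4 5) {v x y z : V} (hK : G.K4 v x y z) :
    ∃ p q, (G.K4 v x p q ∨ G.K4 v y p q ∨ G.K4 v z p q) ∧
      ∀ u, G.Adj v u ∧ u ≠ x ∧ u ≠ y ∧ u ≠ z ↔ u = p ∨ u = q := by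
  classical
  obtain ⟨R, hR, hRv⟩ := h.exists_rest4 hK
  obtain ⟨p, q, hpq, rfl⟩ := card_eq_two.1 (show R.card = 2 by omega)
  simp only [mem_insert, mem_singleton] at hRv
  have hp := (hRv p).1 (Or.inl rfl)
  have hno1 : ¬ (G.Adj p x ∧ G.Adj p y) := fun hh => hp.2.2.2 (h.near4 hK hp.1 hh.1.symm hh.2.symm)
  have hno2 : ¬ (G.Adj p x ∧ G.Adj p z) := fun hh =>
    hp.2.2.1 (h.near4 hK.swap34 hp.1 hh.1.symm hh.2.symm)
  have hno3 : ¬ (G.Adj p y ∧ G.Adj p z) := fun hh =>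
    hp.2.1 (h.near4 hK.swap23.swap34 hp.1 hh.1.symm hh.2.symm)
  obtain ⟨s, t, hst⟩ := h.edge4 hp.1
  refine ⟨p, q, ?_, fun u => (hRv u).symm⟩
  have hs := hRv s
  have ht := hRv t
  obtain ⟨e1, e2, e3, e4, e5, e6⟩ := id hst
  have h1 := e4.ne
  have h2 := e5.ne
  by_cases hsq : s = q
  · subst hsq
    have : t = x ∨ t = y ∨ t = z := by
      by_contra hh
      push Not at hh
      have := ht.2 ⟨e3, hh⟩
      exact this.elim e5.ne' e6.ne'
    rcases this with rfl | rfl | rfl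
    · exact Or.inl hst.swap34.swap23
    · exact Or.inr (Or.inl hst.swap34.swap23)
    · exact Or.inr (Or.inr hst.swap34.swap23)
  · have hs' : s = x ∨ s = y ∨ s = z := by
      by_contra hh
      push Not at hh
      exact (hs.2 ⟨e2, hh⟩).elim e4.ne' hsq
    have ht' : t = q := by
      by_contra htq
      have ht' : t = x ∨ t = y ∨ t = z := by
        by_contra hh
        push Not at hh
        exact (ht.2 ⟨e3, hh⟩).elim e5.ne' htq
      rcases hs' with rfl | rfl | rfl <;> rcases ht' with rfl | rfl | rfl <;> simp_all
    subst ht'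
    rcases hs' with rfl | rfl | rfl
    · exact Or.inl hst.swap23
    · exact Or.inr (Or.inl hst.swap23)
    · exact Or.inr (Or.inr hst.swap23)

/-- The pairs `{v, c}`, `{a, b}`, `{r, s}`, `{p, q}` are the fibres over the 4-cycle; `cover2`
supplies the closing join between `{r, s}` and `{p, q}`. -/
theorem nonempty_iso_four_five (h : CISData G 4 5) (hG : G.Connected) :
    Nonempty (G ≃g (cycleGraph 4).lexProduct (⊤ : SimpleGraph (Fin 2))) := by
  classical
  have main : ∀ v c a b p q, G.K4 v c a b → G.K4 v c p q →
      (∀ u, G.Adj v u ∧ u ≠ c ∧ u ≠ a ∧ u ≠ b ↔ u = p ∨ u = q) →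
      Nonempty (G ≃g (cycleGraph 4).lexProduct (⊤ : SimpleGraph (Fin 2))) := by
    intro v c a b p q hab hpq hv
    obtain ⟨r, s, hrs, ha⟩ := h.exists_double_five hab.rot.rot
    have hp := (hv p).2 (Or.inl rfl)
    have hq := (hv q).2 (Or.inr rfl)
    have hr := (ha r).2 (Or.inl rfl)
    have hs := (ha s).2 (Or.inr rfl)
    have hnap : ¬ G.Adj a p := fun hh =>
      hp.2.2.2 (h.near4 hab hp.1 hpq.2.2.2.1 hh)
    have hnaq : ¬ G.Adj a q := fun hh =>
      hq.2.2.2 (h.near4 hab hq.1 hpq.2.2.2.2.1 hh)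
    have hvr : ¬ G.Adj v r := fun hh => by
      rcases (hv r).1 ⟨hh, hr.2.2.2, hr.1.ne', hr.2.1⟩ with rfl | rfl
      · exact hnap hr.1
      · exact hnaq hr.1
    have hcr : ¬ G.Adj c r := fun hh => by
      have e := h.nbr_eq (v := c) (N := {v, a, b, p, q}) (by
        have := hab.1; have := hab.2.2.2; have := hpq.2.2.2
        simp [*, G.adj_comm c v]) (by
        have := hab.2.1; have := hab.2.2.1; have := hab.2.2.2.2.2; have := hpq.2.2.2.2.2
        have := hpq.2.1; have := hpq.2.2.1
        rw [card_insert_of_notMem, card_insert_of_notMem, card_insert_of_notMem,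
          card_insert_of_notMem, card_singleton] <;> simp <;> grind [Adj.ne]) r
      have := e.1 hh
      have := hr.1.ne
      simp only [mem_insert, mem_singleton] at *
      grind
    have hK : G.K4 a b r s := by
      rcases hrs with h1 | h1 | h1
      · exact h1
      · exact absurd h1.2.2.2.1 hvr
      · exact absurd h1.2.2.2.1 hcr
    have c1 := h.cover2 hab hp.1 hpq.2.2.2.1 hr.1 hK.2.2.2.1
    have c2 := h.cover2 hab hp.1 hpq.2.2.2.1 hs.1 hK.2.2.2.2.1
    have c3 := h.cover2 hab hq.1 hpq.2.2.2.2.1 hr.1 hK.2.2.2.1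
    have c4 := h.cover2 hab hq.1 hpq.2.2.2.2.1 hs.1 hK.2.2.2.2.1
    have hcs : ¬ G.Adj v s := fun hh => by
      rcases (hv s).1 ⟨hh, hs.2.2.2, hs.1.ne', hs.2.1⟩ with rfl | rfl
      · exact hnap hs.1
      · exact hnaq hs.1
    let f : Fin 4 × Fin 2 → V := fun x => ![![v, c], ![a, b], ![r, s], ![p, q]] x.1 x.2
    obtain ⟨a1, a2, a3, a4, a5, a6⟩ := hab
    obtain ⟨b1, b2, b3, b4, b5, b6⟩ := hpq
    obtain ⟨d1, d2, d3, d4, d5, d6⟩ := hK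
    refine hG.nonempty_iso_of_degree h f ?_ ?_ (by decide)
    · have : ∀ x y, x ≠ y → f x ≠ f y := by
        rintro ⟨i, x⟩ ⟨j, y⟩ hne
        fin_cases i <;> fin_cases x <;> fin_cases j <;> fin_cases y <;>
          first
          | exact absurd rfl hne
          | (simp [f]; grind [Adj.ne])
      exact fun x y hxy => by_contra fun hne => this x y hne hxy
    · rintro ⟨i, x⟩ ⟨j, y⟩ hadj
      fin_cases i <;> fin_cases x <;> fin_cases j <;> fin_cases y <;>
        first
        | exact absurd hadj (by decide)
        | (simp [f]; first | assumption | (rw [G.adj_comm]; assumption))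
  obtain ⟨v⟩ := h.exists_vertex
  obtain ⟨N, hN, hNv⟩ := h.reg v
  obtain ⟨u, hu⟩ := card_pos.1 (show 0 < N.card by omega)
  obtain ⟨y, z, hK⟩ := h.edge4 ((hNv u).1 hu)
  obtain ⟨p, q, hpq, hv⟩ := h.exists_double_five hK
  rcases hpq with hpq | hpq | hpq
  · exact main v u y z p q hK hpq hv
  · exact main v y u z p q hK.swap23 hpq (fun w => by rw [← hv]; tauto)
  · exact main v z u y p q hK.swap34.swap23 hpq (fun w => by rw [← hv]; tauto)

/-- Two cliques sharing only an edge `vc` would use five neighbours of `v`, and `false_of_cross`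
excludes a clique through the sixth. Hence the three outer neighbours of a clique vertex form its
second clique. -/
theorem gridData_four (h : CISData G 4 6) : GridData G 4 := by
  classical
  have claim : ∀ {v c a b p q}, G.K4 v c a b → G.K4 v c p q → p ≠ a → p ≠ b → False := by
    intro v c a b p q h1 h2 hpa hpb
    have hqa : q ≠ a := by
      rintro rfl
      exact hpb (h.near4 h1 h2.2.1 h2.2.2.2.1 h2.2.2.2.2.2.symm)
    have hqb : q ≠ b := by
      rintro rfl
      exact hpa (h.near4 h1.swap34 h2.2.1 h2.2.2.2.1 h2.2.2.2.2.2.symm)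
    obtain ⟨a1, a2, a3, a4, a5, a6⟩ := id h1
    obtain ⟨b1, b2, b3, b4, b5, b6⟩ := id h2
    obtain ⟨R, hR, hRv⟩ := h.exists_rest (v := v) (L := {c, a, b, p, q}) (by simp [*])
    have hL : ({c, a, b, p, q} : Finset V).card = 5 := by
      rw [card_insert_of_notMem, card_insert_of_notMem, card_insert_of_notMem,
          card_insert_of_notMem, card_singleton] <;> simp <;> grind [Adj.ne]
    rw [hL] at hR
    obtain ⟨r, rfl⟩ := card_eq_one.1 (show R.card = 1 by omega)
    simp only [mem_insert, mem_singleton] at hRv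
    have hr := (hRv r).1 rfl
    push Not at hr
    obtain ⟨s, t, hst⟩ := h.edge4 hr.1
    obtain ⟨d1, d2, d3, d4, d5, d6⟩ := id hst
    have hs := mt (hRv s).2 d4.ne'
    have ht := mt (hRv t).2 d5.ne'
    have hs' : s = c ∨ s = a ∨ s = b ∨ s = p ∨ s = q := by
      by_contra hh; exact hs ⟨d2, hh⟩
    have ht' : t = c ∨ t = a ∨ t = b ∨ t = p ∨ t = q := by
      by_contra hh; exact ht ⟨d3, hh⟩
    exact h.false_of_cross h1 h2 hpa hpb hqa hqb hr hst hs' ht'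
  constructor
  · intro D E hD hE u v huv h1 h2 h3 h4
    by_contra hne
    obtain ⟨x, y, z, hK, rfl⟩ := hD.exists_K4 h1
    obtain ⟨x', y', z', hK', rfl⟩ := hE.exists_K4 h2
    have norm : ∀ x y z, G.K4 u x y z → v ∈ ({u, x, y, z} : Finset V) →
        ∃ y' z', G.K4 u v y' z' ∧ ({u, x, y, z} : Finset V) = {u, v, y', z'} := by
      intro x y z hK hv
      simp only [mem_insert, mem_singleton] at hv
      rcases hv with hv | rfl | rfl | rfl
      · exact absurd hv.symm huv
      · exact ⟨y, z, hK, rfl⟩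
      · exact ⟨x, z, hK.swap23, by grind⟩
      · exact ⟨x, y, hK.swap34.swap23, by grind⟩
    obtain ⟨a, b, hab, e1⟩ := norm x y z hK h3
    obtain ⟨p, q, hpq, e2⟩ := norm x' y' z' hK' h4
    rw [e1, e2] at hne
    by_cases hpa : p = a
    · subst hpa
      exact hne (by rw [h.near4 hab hpq.2.2.1 hpq.2.2.2.2.1 hpq.2.2.2.2.2])
    · by_cases hpb : p = b
      · subst hpb
        refine hne ?_
        rw [h.near4 hab.swap34 hpq.2.2.1 hpq.2.2.2.2.1 hpq.2.2.2.2.2]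
        grind
      · exact claim hab hpq hpa hpb
  · intro D v hD hv
    obtain ⟨x, y, z, hK, rfl⟩ := hD.exists_K4 hv
    obtain ⟨R, hR, hRv⟩ := h.exists_rest4 hK
    obtain ⟨p, hp⟩ := card_pos.1 (show 0 < R.card by omega)
    have hp' := (hRv p).1 hp
    obtain ⟨s, t, hst⟩ := h.edge4 hp'.1
    have hmem : ∀ s t, G.K4 v p s t → s ∈ R := by
      intro s t hst
      refine (hRv s).2 ⟨hst.2.1, ?_, ?_, ?_⟩
      · rintro rfl
        exact claim hK hst.swap23 hp'.2.2.1 hp'.2.2.2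
      · rintro rfl
        exact claim hK.swap23 hst.swap23 hp'.2.1 hp'.2.2.2
      · rintro rfl
        exact claim hK.swap34.swap23 hst.swap23 hp'.2.1 hp'.2.2.1
    have hR3 : ({p, s, t} : Finset V) = R := by
      refine eq_of_subset_of_card_le ?_ ?_
      · have := hmem s t hst
        have := hmem t s hst.swap34
        grind
      · rw [card_eq_three.2 ⟨p, s, t, hst.2.2.2.1.ne, hst.2.2.2.2.1.ne, hst.2.2.2.2.2.ne, rfl⟩]
        omega
    refine ⟨{v, p, s, t}, hst.isNClique, by simp, ?_, ?_⟩
    · intro hh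
      have : p ∈ ({v, x, y, z} : Finset V) := hh ▸ by simp
      simp only [mem_insert, mem_singleton] at this
      have := hp'.1.ne'
      grind
    · intro u hu
      by_cases huR : u ∈ R
      · right
        rw [← hR3] at huR
        exact mem_insert_of_mem huR
      · left
        have := mt (hRv u).2 huR
        simp only [mem_insert, mem_singleton]
        grind

end CISData

/-! ### Cliques of size four, valency seven: twins -/

/-- `v` and `c` are adjacent and have the same closed neighbourhood. -/
def Twin (G : SimpleGraph V) (v c : V) : Prop :=
  G.Adj v c ∧ ∀ u, u ≠ v → u ≠ c → (G.Adj v u ↔ G.Adj c u)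

/-- The cliques at `v` form a path: `{v,a,b,c}`, `{v,c,d,e}`, `{v,e,f,g}`. -/
structure LinePath (G : SimpleGraph V) (v a b c d e f g : V) : Prop where
  adj_iff : ∀ u, G.Adj v u ↔ u = a ∨ u = b ∨ u = c ∨ u = d ∨ u = e ∨ u = f ∨ u = g
  fst : G.K4 v c a b
  mid : G.K4 v c d e
  lst : G.K4 v e f g
  nodup : [a, b, c, d, e, f, g].Nodup

namespace CISData

variable (h : CISData G 4 7)
include h

/-- Otherwise every clique through `v` and an outer neighbour would stay among the four outer
neighbours. Such a clique takes three of them, and the clique through the fourth uses two of these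
three, against `near4`. -/
theorem exists_double {v x y z : V} (hK : G.K4 v x y z) :
    ∃ p q, (p ≠ x ∧ p ≠ y ∧ p ≠ z) ∧ (q ≠ x ∧ q ≠ y ∧ q ≠ z) ∧
      (G.K4 v x p q ∨ G.K4 v y p q ∨ G.K4 v z p q) := by
  classical
  by_contra hno
  push Not at hno
  obtain ⟨R, hR, hRv⟩ := h.exists_rest4 hK
  have key : ∀ p ∈ R, ∀ s t, G.K4 v p s t → s ∈ R := by
    intro p hp s t hst
    rw [hRv] at hp
    obtain ⟨d1, d2, d3, d4, d5, d6⟩ := id hst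
    have nxy : ¬ (G.Adj x p ∧ G.Adj y p) := fun hh =>
      hp.2.2.2 (h.near4 hK hp.1 hh.1 hh.2)
    have nxz : ¬ (G.Adj x p ∧ G.Adj z p) := fun hh =>
      hp.2.2.1 (h.near4 hK.swap34 hp.1 hh.1 hh.2)
    have nyz : ¬ (G.Adj y p ∧ G.Adj z p) := fun hh =>
      hp.2.1 (h.near4 hK.swap23.swap34 hp.1 hh.1 hh.2)
    refine (hRv s).2 ⟨d2, ?_, ?_, ?_⟩
    · rintro rfl
      refine (hno p t hp.2 ⟨d6.ne', ?_, ?_⟩).1 hst.swap23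
      · rintro rfl; exact nxy ⟨d4.symm, d5.symm⟩
      · rintro rfl; exact nxz ⟨d4.symm, d5.symm⟩
    · rintro rfl
      refine (hno p t hp.2 ⟨?_, d6.ne', ?_⟩).2.1 hst.swap23
      · rintro rfl; exact nxy ⟨d5.symm, d4.symm⟩
      · rintro rfl; exact nyz ⟨d4.symm, d5.symm⟩
    · rintro rfl
      refine (hno p t hp.2 ⟨?_, ?_, d6.ne'⟩).2.2 hst.swap23
      · rintro rfl; exact nxz ⟨d5.symm, d4.symm⟩
      · rintro rfl; exact nyz ⟨d5.symm, d4.symm⟩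
  obtain ⟨p, hp⟩ := card_pos.1 (show 0 < R.card by omega)
  obtain ⟨s, t, hst⟩ := h.edge4 ((hRv p).1 hp).1
  have hs := key p hp s t hst
  have ht := key p hp t s hst.swap34
  have hpst : ({p, s, t} : Finset V).card = 3 :=
    card_eq_three.2 ⟨p, s, t, hst.2.2.2.1.ne, hst.2.2.2.2.1.ne, hst.2.2.2.2.2.ne, rfl⟩
  have hRc := card_sdiff_add_card_eq_card (show ({p, s, t} : Finset V) ⊆ R by grind)
  obtain ⟨r, hr⟩ := card_eq_one.1 (show (R \ {p, s, t}).card = 1 by omega)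
  have hrm : ∀ u, u ∈ R ∧ u ≠ p ∧ u ≠ s ∧ u ≠ t ↔ u = r := by
    intro u
    have : u ∈ R \ {p, s, t} ↔ u ∈ ({r} : Finset V) := by rw [hr]
    simpa using this
  obtain ⟨hrR, hrp, hrs, hrt⟩ := (hrm r).2 rfl
  have hvr := ((hRv r).1 hrR).1
  obtain ⟨s', t', hst'⟩ := h.edge4 hvr
  obtain ⟨d1, d2, d3, d4, d5, d6⟩ := id hst'
  have hs' : s' = p ∨ s' = s ∨ s' = t := by
    by_contra hh
    push Not at hh
    exact d4.ne' ((hrm s').1 ⟨key r hrR s' t' hst', hh⟩)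
  have ht' : t' = p ∨ t' = s ∨ t' = t := by
    by_contra hh
    push Not at hh
    exact d5.ne' ((hrm t').1 ⟨key r hrR t' s' hst'.swap34, hh⟩)
  have e1 : ¬ (G.Adj p r ∧ G.Adj s r) := fun hh => hrt (h.near4 hst hvr hh.1 hh.2)
  have e2 : ¬ (G.Adj p r ∧ G.Adj t r) := fun hh => hrs (h.near4 hst.swap34 hvr hh.1 hh.2)
  have e3 : ¬ (G.Adj s r ∧ G.Adj t r) := fun hh =>
    hrp (h.near4 hst.swap23.swap34 hvr hh.1 hh.2)
  have d4' := d4.symm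
  have d5' := d5.symm
  have d6' := d6.ne
  rcases hs' with rfl | rfl | rfl <;> rcases ht' with rfl | rfl | rfl <;> simp_all

theorem twin_of_subset {a b : V} (hab : G.Adj a b)
    (hsub : ∀ r, G.Adj a r → r ≠ b → G.Adj b r) : G.Twin a b := by
  classical
  obtain ⟨N, hN, hNa⟩ := h.reg a
  have hb : b ∈ N := (hNa b).2 hab
  have := h.nbr_eq (v := b) (N := insert a (N.erase b)) (by
    intro u hu
    rw [mem_insert, mem_erase] at hu
    rcases hu with rfl | hu
    · exact hab.symm
    · exact hsub u ((hNa u).1 hu.2) hu.1) (by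
    rw [card_insert_of_notMem, card_erase_of_mem hb]
    · omega
    · rw [mem_erase, hNa]
      exact fun hh => G.irrefl hh.2)
  refine ⟨hab, fun u hua hub => ?_⟩
  rw [this, mem_insert, mem_erase, hNa]
  grind

/-- Two cliques on an edge `vc` use five neighbours of `v`. By `false_of_cross`, a clique through a
sixth contains the seventh and one earlier vertex `w`. If `w = c`, then `c` is a twin of `v`;
otherwise the cliques form a path. -/
theorem twin_or_linePath (v : V) :
    (∃ c, G.Twin v c) ∨ ∃ a b c d e f g, G.LinePath v a b c d e f g := by
  classical
  have main : ∀ c a b d e, G.K4 v c a b → G.K4 v c d e → d ≠ a → d ≠ b → e ≠ a → e ≠ b →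
      (∃ c, G.Twin v c) ∨ ∃ a b c d e f g, G.LinePath v a b c d e f g := by
    intro c a b d e h1 h2 hda hdb hea heb
    obtain ⟨a1, a2, a3, a4, a5, a6⟩ := id h1
    obtain ⟨b1, b2, b3, b4, b5, b6⟩ := id h2
    obtain ⟨R, hR, hRv⟩ := h.exists_rest (v := v) (L := {c, a, b, d, e}) (by simp [*])
    have hL : ({c, a, b, d, e} : Finset V).card = 5 := by
      rw [card_insert_of_notMem, card_insert_of_notMem, card_insert_of_notMem,
          card_insert_of_notMem, card_singleton] <;> simp <;> grind [Adj.ne]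
    rw [hL] at hR
    obtain ⟨f, g, hfg, rfl⟩ := card_eq_two.1 (show R.card = 2 by omega)
    simp only [mem_insert, mem_singleton, not_or] at hRv
    have hf := (hRv f).1 (Or.inl rfl)
    have hg := (hRv g).1 (Or.inr rfl)
    have hadj : ∀ u, G.Adj v u ↔ u = a ∨ u = b ∨ u = c ∨ u = d ∨ u = e ∨ u = f ∨ u = g := by
      intro u
      constructor
      · intro hu
        have := hRv u
        grind
      · rintro (rfl | rfl | rfl | rfl | rfl | rfl | rfl)
        exacts [a2, a3, a1, b2, b3, hf.1, hg.1]
    obtain ⟨w, hw, hK⟩ : ∃ w, (w = c ∨ w = a ∨ w = b ∨ w = d ∨ w = e) ∧ G.K4 v w f g := by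
      obtain ⟨s, t, hst⟩ := h.edge4 hf.1
      obtain ⟨d1, d2, d3, d4, d5, d6⟩ := id hst
      have hs : (s = c ∨ s = a ∨ s = b ∨ s = d ∨ s = e) ∨ s = g := by
        have := (hadj s).1 d2
        have := d4.ne'
        grind
      have ht : (t = c ∨ t = a ∨ t = b ∨ t = d ∨ t = e) ∨ t = g := by
        have := (hadj t).1 d3
        have := d5.ne'
        grind
      rcases hs with hs | rfl
      · rcases ht with ht | rfl
        · exact (h.false_of_cross h1 h2 hda hdb hea heb hf hst hs ht).elim
        · exact ⟨s, hs, hst.swap23⟩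
      · exact ⟨t, ht.resolve_right d6.ne', hst.swap34.swap23⟩
    have e1 := a4.ne
    have e2 := a5.ne
    have e3 := a6.ne
    have e4 := b4.ne
    have e5 := b5.ne
    have e6 := b6.ne
    rcases hw with rfl | rfl | rfl | rfl | rfl
    · left
      refine ⟨w, h.twin_of_subset a1 fun r hr hrw => ?_⟩
      rcases (hadj r).1 hr with rfl | rfl | rfl | rfl | rfl | rfl | rfl
      exacts [a4, a5, absurd rfl hrw, b4, b5, hK.2.2.2.1, hK.2.2.2.2.1]
    · right
      refine ⟨d, e, c, b, w, f, g, fun u => ?_, h2, h1.swap34, hK, ?_⟩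
      · rw [hadj]; grind
      · simp only [List.nodup_cons, List.mem_cons, List.not_mem_nil, not_false_eq_true,
          List.nodup_nil, or_false, not_or]
        grind
    · right
      refine ⟨d, e, c, a, w, f, g, fun u => ?_, h2, h1, hK, ?_⟩
      · rw [hadj]; grind
      · simp only [List.nodup_cons, List.mem_cons, List.not_mem_nil, not_false_eq_true,
          List.nodup_nil, or_false, not_or]
        grind
    · right
      refine ⟨a, b, c, e, w, f, g, fun u => ?_, h1, h2.swap34, hK, ?_⟩
      · rw [hadj]; grind
      · simp only [List.nodup_cons, List.mem_cons, List.not_mem_nil, not_false_eq_true,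
          List.nodup_nil, or_false, not_or]
        grind
    · right
      refine ⟨a, b, c, d, w, f, g, fun u => ?_, h1, h2, hK, ?_⟩
      · rw [hadj]
      · simp only [List.nodup_cons, List.mem_cons, List.not_mem_nil, not_false_eq_true,
          List.nodup_nil, or_false, not_or]
        grind
  obtain ⟨N, hN, hNv⟩ := h.reg v
  obtain ⟨x, hx⟩ := card_pos.1 (show 0 < N.card by omega)
  obtain ⟨y, z, hK⟩ := h.edge4 ((hNv x).1 hx)
  obtain ⟨p, q, hp, hq, hh⟩ := h.exists_double hK
  rcases hh with hh | hh | hh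
  · exact main x y z p q hK hh hp.2.1 hp.2.2 hq.2.1 hq.2.2
  · exact main y x z p q hK.swap23 hh hp.1 hp.2.2 hq.1 hq.2.2
  · exact main z x y p q hK.swap34.swap23 hh hp.1 hp.2.1 hq.1 hq.2.1

/-- The cliques at a vertex `v` with a twin `c`. -/
theorem exists_windmill {v c a b : V} (ht : G.Twin v c) (hK : G.K4 v c a b) :
    ∃ d e f g, G.K4 v c d e ∧ G.K4 v c f g ∧ [c, a, b, d, e, f, g].Nodup := by
  classical
  obtain ⟨R, hR, hRv⟩ := h.exists_rest4 hK
  have key : ∀ x y, G.K4 v c x y → ∀ d, G.Adj v d → d ≠ c → d ≠ x → d ≠ y →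
      ∃ e, G.K4 v c d e ∧ e ≠ x ∧ e ≠ y := by
    intro x y hxy d hd hdc hdx hdy
    have hcd : G.Adj c d := (ht.2 d hd.ne' hdc).1 hd
    obtain ⟨e, hde⟩ := h.tri4 ht.1 hd hcd
    refine ⟨e, hde, ?_, ?_⟩
    · rintro rfl; exact hdy (h.near4 hxy hd hcd hde.2.2.2.2.2.symm)
    · rintro rfl; exact hdx (h.near4 hxy.swap34 hd hcd hde.2.2.2.2.2.symm)
  obtain ⟨d, hd⟩ := card_pos.1 (show 0 < R.card by omega)
  have hd' := (hRv d).1 hd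
  obtain ⟨e, hde, hea, heb⟩ := key a b hK d hd'.1 hd'.2.1 hd'.2.2.1 hd'.2.2.2
  have heR : e ∈ R := (hRv e).2 ⟨hde.2.2.1, hde.2.2.2.2.1.ne', hea, heb⟩
  have hc := card_sdiff_add_card_eq_card (show ({d, e} : Finset V) ⊆ R by grind)
  rw [card_pair hde.2.2.2.2.2.ne] at hc
  obtain ⟨f, hf⟩ := card_pos.1 (show 0 < (R \ {d, e}).card by omega)
  simp only [mem_sdiff, mem_insert, mem_singleton, not_or] at hf
  have hf' := (hRv f).1 hf.1
  obtain ⟨g, hfg, hga, hgb⟩ := key a b hK f hf'.1 hf'.2.1 hf'.2.2.1 hf'.2.2.2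
  obtain ⟨g', hfg', hgd, hge⟩ := key d e hde f hf'.1 hf'.2.1 hf.2.1 hf.2.2
  obtain rfl : g' = g := h.near4 hfg hfg'.2.2.1 hfg'.2.2.2.2.1 hfg'.2.2.2.2.2
  have hgR : g' ∈ R := (hRv g').2 ⟨hfg.2.2.1, hfg.2.2.2.2.1.ne', hga, hgb⟩
  refine ⟨d, e, f, g', hde, hfg, ?_⟩
  have := hK.2.2.2.1.ne
  have := hK.2.2.2.2.1.ne
  have := hK.2.2.2.2.2.ne
  have := hde.2.2.2.2.2.ne
  have := hfg.2.2.2.2.2.ne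
  have he' := (hRv e).1 heR
  have hg' := (hRv g').1 hgR
  simp only [List.nodup_cons, List.mem_cons, List.not_mem_nil, not_false_eq_true,
        List.nodup_nil, or_false, not_or]
  grind

/-- The edges `va` and `ca` lie in one clique only, so the second clique at `a` is some `{a, b, p,
q}`. By `cover2`, `p` and `q` are joined to `d, e, f, g`, which fills their neighbourhoods. A
neighbour of `a` missing `b` would then lie in a clique that gives `a` eight neighbours. -/
theorem twin_of_adj_twin {v c a b : V} (ht : G.Twin v c) (hK : G.K4 v c a b) : G.Twin a b := by
  classical
  obtain ⟨p, q, hp, hq, hpq⟩ := h.exists_double hK.pairs.swap23.swap34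
  have hvca : ∀ r, G.Adj v r → r ≠ c → G.Adj a r → r = b := fun r hr hrc har =>
    h.near4 hK hr ((ht.2 r hr.ne' hrc).1 hr) har
  have hcva : ∀ r, G.Adj c r → r ≠ v → G.Adj a r → r = b := fun r hr hrv har =>
    h.near4 hK ((ht.2 r hrv hr.ne').2 hr) hr har
  have hab : G.K4 a b p q := by
    rcases hpq with hpq | hpq | hpq
    · exact absurd (hvca p hpq.2.2.2.1 hp.2.1 hpq.2.1) hp.2.2
    · exact absurd (hcva p hpq.2.2.2.1 hp.1 hpq.2.1) hp.2.2
    · exact hpq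
  obtain ⟨d, e, f, g, hde, hfg, hnd⟩ := h.exists_windmill ht hK
  simp only [List.nodup_cons, List.mem_cons, List.not_mem_nil, not_false_eq_true,
          List.nodup_nil, or_false, not_or] at hnd
  have hfull : ∀ {p q}, G.K4 a b p q → ∀ r, G.Adj p r →
      r = a ∨ r = b ∨ r = q ∨ r = d ∨ r = e ∨ r = f ∨ r = g := by
    intro p q hab r hr
    have c1 := h.cover2 hK hde.2.1 hde.2.2.2.1 hab.2.1 hab.2.2.2.1
    have c2 := h.cover2 hK hde.2.2.1 hde.2.2.2.2.1 hab.2.1 hab.2.2.2.1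
    have c3 := h.cover2 hK hfg.2.1 hfg.2.2.2.1 hab.2.1 hab.2.2.2.1
    have c4 := h.cover2 hK hfg.2.2.1 hfg.2.2.2.2.1 hab.2.1 hab.2.2.2.1
    have hq : ∀ x, G.Adj v x → x ≠ c → x ≠ b → q ≠ x := by
      rintro x hx hxc hxb rfl
      exact hxb (hvca q hx hxc hab.2.2.1)
    have q1 := hq d hde.2.1 (by grind) (by grind)
    have q2 := hq e hde.2.2.1 (by grind) (by grind)
    have q3 := hq f hfg.2.1 (by grind) (by grind)
    have q4 := hq g hfg.2.2.1 (by grind) (by grind)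
    have := h.nbr_eq (v := p) (N := {a, b, q, d, e, f, g}) (by
      simp [c1.symm, c2.symm, c3.symm, c4.symm, hab.2.1.symm, hab.2.2.2.1.symm, hab.2.2.2.2.2]) (by
      have := hab.2.2.1.ne
      have := hab.2.2.2.2.1.ne
      have := hab.1.ne
      rw [card_insert_of_notMem, card_insert_of_notMem, card_insert_of_notMem,
          card_insert_of_notMem, card_insert_of_notMem, card_insert_of_notMem, card_singleton] <;>
          simp <;> grind) r
    simpa using this.1 hr
  have hnot : ∀ x, G.Adj v x → x ≠ c → x ≠ b → ¬ G.Adj a x := fun x hx hxc hxb hax =>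
    hxb (hvca x hx hxc hax)
  have nd := hnot d hde.2.1 (by grind) (by grind)
  have ne := hnot e hde.2.2.1 (by grind) (by grind)
  have nf := hnot f hfg.2.1 (by grind) (by grind)
  have ng := hnot g hfg.2.2.1 (by grind) (by grind)
  have hfull' : ∀ {p q}, G.K4 a b p q → ∀ r, G.Adj p r → G.Adj a r → r = b ∨ r = q := by
    intro p q hab r hpr har
    rcases hfull hab r hpr with rfl | rfl | rfl | rfl | rfl | rfl | rfl
    · exact absurd har G.irrefl
    · exact Or.inl rfl
    · exact Or.inr rfl
    all_goals contradiction
  refine h.twin_of_subset hab.1 fun r har hrb => ?_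
  by_cases hrv : r = v
  · exact hrv ▸ hK.2.2.1.symm
  by_cases hrc : r = c
  · exact hrc ▸ hK.2.2.2.2.1.symm
  by_cases hrp : r = p
  · exact hrp ▸ hab.2.2.2.1
  by_cases hrq : r = q
  · exact hrq ▸ hab.2.2.2.2.1
  obtain ⟨s, t, hst⟩ := h.edge4 har
  have hbad : ∀ s, G.Adj r s → s ≠ v ∧ s ≠ c ∧ s ≠ p ∧ s ≠ q := by
    intro s hrs
    refine ⟨?_, ?_, ?_, ?_⟩ <;> rintro rfl
    · exact hrb (hvca r hrs.symm hrc har)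
    · exact hrb (hcva r hrs.symm hrv har)
    · exact (hfull' hab r hrs.symm har).elim hrb hrq
    · exact (hfull' hab.swap34 r hrs.symm har).elim hrb hrp
  by_contra hbr
  obtain ⟨d1, d2, d3, d4, d5, d6⟩ := id hst
  have hs := hbad s d4
  have ht' := hbad t d5
  have hsb : s ≠ b := fun hh => hbr (hh ▸ d4.symm)
  have htb : t ≠ b := fun hh => hbr (hh ▸ d5.symm)
  obtain ⟨N, hN, hNa⟩ := h.reg a
  have hsub : ({v, c, b, p, q, r, s, t} : Finset V) ⊆ N := by
    intro x hx
    simp only [mem_insert, mem_singleton] at hx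
    rw [hNa]
    rcases hx with rfl | rfl | rfl | rfl | rfl | rfl | rfl | rfl
    exacts [hK.2.1.symm, hK.2.2.2.1.symm, hab.1, hab.2.1, hab.2.2.1, d1, d2, d3]
  have := card_le_card hsub
  rw [hN, card_insert_of_notMem, card_insert_of_notMem, card_insert_of_notMem,
          card_insert_of_notMem, card_insert_of_notMem, card_insert_of_notMem,
          card_insert_of_notMem, card_singleton] at this
  · omega
  all_goals
    simp only [mem_insert, mem_singleton]
    have := ht.1.ne
    have := hK.2.2.1.ne
    have := hK.2.2.2.2.1.ne
    have := hab.2.2.2.1.ne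
    have := hab.2.2.2.2.1.ne
    have := hab.2.2.2.2.2.ne
    have := d4.ne
    have := d5.ne
    have := d6.ne
    grind

end CISData

instance completeBipartiteGraph.decidableAdj {W X : Type*} :
    DecidableRel (completeBipartiteGraph W X).Adj :=
  fun _ _ => inferInstanceAs (Decidable (_ ∨ _))

/-- The windmills at `v` and at `a` provide the two sides, three adjacent pairs each, and `cover2`
joins across. -/
theorem CISData.nonempty_iso_of_twin (h : CISData G 4 7) (hG : G.Connected) {v c : V}
    (ht : G.Twin v c) : Nonempty (G ≃g
      (completeBipartiteGraph (Fin 3) (Fin 3)).lexProduct (⊤ : SimpleGraph (Fin 2))) := by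
  classical
  obtain ⟨a, b, hK⟩ := h.edge4 ht.1
  obtain ⟨d, e, f, g, hde, hfg, hnd⟩ := h.exists_windmill ht hK
  obtain ⟨p, q, p', q', hpq, hpq', hnd'⟩ := h.exists_windmill (h.twin_of_adj_twin ht hK)
    hK.pairs
  have cross : ∀ {x y s t}, G.K4 v c x y → G.K4 a b s t →
      G.Adj s x ∧ G.Adj s y ∧ G.Adj t x ∧ G.Adj t y := by
    intro x y s t hxy hst
    obtain ⟨d1, d2, d3, d4, d5, d6⟩ := hxy
    obtain ⟨e1, e2, e3, e4, e5, e6⟩ := hst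
    exact ⟨(h.cover2 hK d2 d4 e2 e4).symm, (h.cover2 hK d3 d5 e2 e4).symm,
      (h.cover2 hK d2 d4 e3 e5).symm, (h.cover2 hK d3 d5 e3 e5).symm⟩
  let A : Fin 3 → Fin 2 → V := ![![v, c], ![p, q], ![p', q']]
  let B : Fin 3 → Fin 2 → V := ![![a, b], ![d, e], ![f, g]]
  have hAB : ∀ i x j y, G.Adj (A i x) (B j y) := by
    obtain ⟨c1, c2, c3, c4⟩ := cross hde hpq
    obtain ⟨c5, c6, c7, c8⟩ := cross hfg hpq
    obtain ⟨c9, c10, c11, c12⟩ := cross hde hpq'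
    obtain ⟨c13, c14, c15, c16⟩ := cross hfg hpq'
    have := hK.2.1
    have := hK.2.2.1
    have := hK.2.2.2.1
    have := hK.2.2.2.2.1
    have := hde.2.1
    have := hde.2.2.1
    have := hde.2.2.2.1
    have := hde.2.2.2.2.1
    have := hfg.2.1
    have := hfg.2.2.1
    have := hfg.2.2.2.1
    have := hfg.2.2.2.2.1
    have := hpq.2.1.symm
    have := hpq.2.2.1.symm
    have := hpq.2.2.2.1.symm
    have := hpq.2.2.2.2.1.symm
    have := hpq'.2.1.symm
    have := hpq'.2.2.1.symm
    have := hpq'.2.2.2.1.symm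
    have := hpq'.2.2.2.2.1.symm
    intro i x j y
    fin_cases i <;> fin_cases x <;> fin_cases j <;> fin_cases y <;> simp [A, B] <;> assumption
  have hAA : ∀ i x y, x ≠ y → G.Adj (A i x) (A i y) := by
    have h1 := ht.1
    have h2 := hpq.2.2.2.2.2
    have h3 := hpq'.2.2.2.2.2
    intro i x y hxy
    fin_cases i <;> fin_cases x <;> fin_cases y <;> first
      | exact absurd rfl hxy
      | (simp [A, h1, h2, h3, h1.symm, h2.symm, h3.symm])
  have hBB : ∀ i x y, x ≠ y → G.Adj (B i x) (B i y) := by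
    have h1 := hK.2.2.2.2.2
    have h2 := hde.2.2.2.2.2
    have h3 := hfg.2.2.2.2.2
    intro i x y hxy
    fin_cases i <;> fin_cases x <;> fin_cases y <;> first
      | exact absurd rfl hxy
      | (simp [B, h1, h2, h3, h1.symm, h2.symm, h3.symm])
  simp only [List.nodup_cons, List.mem_cons, List.not_mem_nil, not_false_eq_true,
          List.nodup_nil, or_false, not_or] at hnd hnd'
  have hAinj : ∀ i x j y, A i x = A j y → i = j := by
    intro i x j y
    fin_cases i <;> fin_cases x <;> fin_cases j <;> fin_cases y <;> simp [A] <;> grind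
  have hBinj : ∀ i x j y, B i x = B j y → i = j := by
    intro i x j y
    fin_cases i <;> fin_cases x <;> fin_cases j <;> fin_cases y <;> simp [B] <;> grind
  let F : (Fin 3 ⊕ Fin 3) × Fin 2 → V := fun z => Sum.elim A B z.1 z.2
  refine hG.nonempty_iso_of_degree h F ?_ ?_ (by decide)
  · rintro ⟨i | i, x⟩ ⟨j | j, y⟩ hxy <;> simp only [F, Sum.elim_inl, Sum.elim_inr] at hxy
    · obtain rfl := hAinj _ _ _ _ hxy
      by_contra hne
      exact (hAA i x y (by rintro rfl; exact hne rfl)).ne hxy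
    · exact absurd hxy (hAB i x j y).ne
    · exact absurd hxy.symm (hAB j y i x).ne
    · obtain rfl := hBinj _ _ _ _ hxy
      by_contra hne
      exact (hBB i x y (by rintro rfl; exact hne rfl)).ne hxy
  · rintro ⟨i | i, x⟩ ⟨j | j, y⟩ hxy <;> simp only [F, Sum.elim_inl, Sum.elim_inr] <;>
      simp [lexProduct] at hxy
    · obtain ⟨rfl, hxy⟩ := hxy
      exact hAA i x y hxy
    · exact hAB i x j y
    · exact (hAB j y i x).symm
    · obtain ⟨rfl, hxy⟩ := hxy
      exact hBB i x y hxy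

/-! ### Paths of cliques, doubled edges and layers -/

namespace LinePath

variable {v a b c d e f g : V}

theorem ne (hP : G.LinePath v a b c d e f g) :
    (a ≠ b ∧ a ≠ c ∧ a ≠ d ∧ a ≠ e ∧ a ≠ f ∧ a ≠ g) ∧ (b ≠ c ∧ b ≠ d ∧ b ≠ e ∧ b ≠ f ∧ b ≠ g) ∧
      (c ≠ d ∧ c ≠ e ∧ c ≠ f ∧ c ≠ g) ∧ (d ≠ e ∧ d ≠ f ∧ d ≠ g) ∧ (e ≠ f ∧ e ≠ g) ∧ f ≠ g := by
  have := hP.nodup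
  simpa [List.nodup_cons, not_or] using this

theorem reverse (hP : G.LinePath v a b c d e f g) : G.LinePath v g f e d c b a where
  adj_iff u := by rw [hP.adj_iff]; grind
  fst := hP.lst.swap34
  mid := hP.mid.swap34.swap23.swap34
  lst := hP.fst.swap34
  nodup := by simpa using List.nodup_reverse.2 hP.nodup

theorem swap (hP : G.LinePath v a b c d e f g) : G.LinePath v b a c d e f g where
  adj_iff u := by rw [hP.adj_iff]; grind
  fst := hP.fst.swap34
  mid := hP.mid
  lst := hP.lst
  nodup := by
    have := hP.ne
    simp only [List.nodup_cons, List.mem_cons, List.not_mem_nil, not_false_eq_true,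
          List.nodup_nil, or_false, not_or]
    grind

theorem not_adj (hP : G.LinePath v a b c d e f g) (h : CISData G 4 7) :
    ¬ G.Adj a d ∧ ¬ G.Adj a e ∧ ¬ G.Adj c f ∧ ¬ G.Adj d f := by
  have hne := hP.ne
  obtain ⟨a1, a2, a3, a4, a5, a6⟩ := hP.fst
  obtain ⟨b1, b2, b3, b4, b5, b6⟩ := hP.mid
  obtain ⟨c1, c2, c3, c4, c5, c6⟩ := hP.lst
  refine ⟨fun hh => ?_, fun hh => ?_, fun hh => ?_, fun hh => ?_⟩
  · exact hne.1.2.2.2.1 (h.near4 hP.mid a2 a4 hh.symm)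
  · exact hne.1.2.2.1 (h.near4 hP.mid.swap34 a2 a4 hh.symm)
  · exact hne.2.2.1.2.2.2 (h.near4 hP.lst b1 b5.symm hh.symm)
  · exact hne.2.2.2.1.2.2 (h.near4 hP.lst b2 b6.symm hh.symm)

theorem K4_fst (hP : G.LinePath v a b c d e f g) (h : CISData G 4 7) {x y : V}
    (hK : G.K4 v a x y) : x = b ∧ y = c ∨ x = c ∧ y = b := by
  have hne := hP.ne
  obtain ⟨n1, n2, -, -⟩ := hP.not_adj h
  obtain ⟨n1', n2', -, -⟩ := hP.swap.not_adj h
  obtain ⟨d1, d2, d3, d4, d5, d6⟩ := id hK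
  have hnot : ∀ {a b : V}, G.LinePath v a b c d e f g → ¬ (G.Adj a f ∧ G.Adj a g) :=
    fun hP hh => hP.ne.1.2.2.2.1
      (h.near4 hP.lst.swap23.swap34 hP.fst.2.1 hh.1.symm hh.2.symm)
  have main : ∀ x y, G.K4 v a x y → x = b ∨ x = c → x = b ∧ y = c ∨ x = c ∧ y = b := by
    intro x y hK hx
    rcases hx with rfl | rfl
    · exact Or.inl ⟨rfl, h.near4 hP.fst.swap23.swap34 hK.2.2.1 hK.2.2.2.2.1 hK.2.2.2.2.2⟩
    · exact Or.inr ⟨rfl, h.near4 hP.fst hK.2.2.1 hK.2.2.2.2.2 hK.2.2.2.2.1⟩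
  by_cases hx : x = b ∨ x = c
  · exact main x y hK hx
  by_cases hy : y = b ∨ y = c
  · exact (main y x hK.swap34 hy).symm.imp And.symm And.symm
  have hx' := (hP.adj_iff x).1 d2
  have hy' := (hP.adj_iff y).1 d3
  have := d4.ne
  have := d5.ne
  have := d6.ne
  have := hnot hP
  grind

theorem K4_mid (hP : G.LinePath v a b c d e f g) (h : CISData G 4 7) {x y : V}
    (hK : G.K4 v d x y) : x = c ∧ y = e ∨ x = e ∧ y = c := by
  obtain ⟨n1, -, -, n2⟩ := hP.not_adj h
  obtain ⟨n1', -, -, n2'⟩ := hP.reverse.not_adj h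
  obtain ⟨d1, d2, d3, d4, d5, d6⟩ := id hK
  have hx := (hP.adj_iff x).1 d2
  have hy := (hP.adj_iff y).1 d3
  have := d4.ne
  have := d5.ne
  have := d6.ne
  have := d4.symm
  have := d5.symm
  have := fun hh : G.Adj d g => n1' hh.symm
  have := fun hh : G.Adj d b => n2' hh
  grind

end LinePath

/-- The edge `uv` lies in two cliques of size four. -/
def Dbl (G : SimpleGraph V) (u v : V) : Prop :=
  ∃ a b p q, G.K4 u v a b ∧ G.K4 u v p q ∧ p ≠ a ∧ p ≠ b

theorem Dbl.symm {u v : V} (hd : G.Dbl u v) : G.Dbl v u := by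
  obtain ⟨a, b, p, q, h1, h2, h3⟩ := hd
  exact ⟨a, b, p, q, h1.swap12, h2.swap12, h3⟩

theorem Dbl.adj {u v : V} (hd : G.Dbl u v) : G.Adj u v := by
  obtain ⟨a, b, p, q, h1, -⟩ := hd
  exact h1.1

namespace LinePath

variable {v a b c d e f g : V}

theorem dbl (hP : G.LinePath v a b c d e f g) : G.Dbl v c :=
  ⟨a, b, d, e, hP.fst, hP.mid, hP.ne.1.2.2.1.symm, hP.ne.2.1.2.1.symm⟩

/-- `K4_fst`, its mirror images and `K4_mid` show that every other edge at `v` lies in one clique.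
Thus doubled edges form a 2-regular graph once all vertices carry paths. -/
theorem eq_of_dbl (hP : G.LinePath v a b c d e f g) (h : CISData G 4 7) {u : V}
    (hu : G.Dbl v u) : u = c ∨ u = e := by
  obtain ⟨x, y, p, q, h1, h2, h3, h4⟩ := hu
  have hfst : ∀ {a b c d e f g}, G.LinePath v a b c d e f g → u ≠ a := by
    rintro a b c d e f g hP rfl
    have := hP.K4_fst h h1
    have := hP.K4_fst h h2
    grind
  have := hfst hP
  have := hfst hP.swap
  have := hfst hP.reverse
  have := hfst hP.reverse.swap
  have : u ≠ d := by
    rintro rfl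
    have := hP.K4_mid h h1
    have := hP.K4_mid h h2
    grind
  have := (hP.adj_iff u).1 h1.1
  grind

end LinePath

/-- The edges `pq`, `qs`, `sr`, `rp` of the clique `{p, q, r, s}` lie in two cliques. -/
def Fr4 (G : SimpleGraph V) (p q r s : V) : Prop :=
  G.K4 p q r s ∧ G.Dbl p q ∧ G.Dbl r s ∧ G.Dbl p r ∧ G.Dbl q s

/-- Maximal cliques have size four, the valency is seven, and the cliques at every vertex form
a path. -/
structure PathData (G : SimpleGraph V) : Prop where
  cis : CISData G 4 7
  exists_path : ∀ v, ∃ a b c d e f g, G.LinePath v a b c d e f g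

namespace PathData

variable (h : PathData G)
include h

theorem exists_linePath {v c e : V} (hc : G.Dbl v c) (he : G.Dbl v e) (hne : c ≠ e) :
    ∃ a b d f g, G.LinePath v a b c d e f g := by
  obtain ⟨a', b', c', d', e', f', g', hP⟩ := h.exists_path v
  rcases hP.eq_of_dbl h.cis hc with rfl | rfl <;> rcases hP.eq_of_dbl h.cis he with rfl | rfl
  · exact absurd rfl hne
  · exact ⟨_, _, _, _, _, hP⟩
  · exact ⟨_, _, _, _, _, hP.reverse⟩
  · exact absurd rfl hne

theorem eq_or_eq {v x y z : V} (hx : G.Dbl v x) (hy : G.Dbl v y) (hne : x ≠ y)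
    (hz : G.Dbl v z) : z = x ∨ z = y := by
  obtain ⟨a, b, d, f, g, hP⟩ := h.exists_linePath hx hy hne
  exact hP.eq_of_dbl h.cis hz

/-- By `exists_double` some edge at `f` inside the clique is doubled, and only `fg` is left. Then
`cover2` joins the two new vertices to `c` and `d`. -/
theorem exists_opposite {u w c d f g : V} (h1 : G.K4 u w f g) (h2 : G.K4 u w c d)
    (hu : ¬ G.Dbl f u) (hw : ¬ G.Dbl f w) :
    ∃ x y, (x ≠ u ∧ x ≠ w) ∧ (y ≠ u ∧ y ≠ w) ∧ G.K4 f g x y ∧ G.K4 c d x y := by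
  obtain ⟨p, q, hp, hq, hh⟩ := h.cis.exists_double h1.pairs.swap23.swap34
  rcases hh with hh | hh | hh
  · exact absurd ⟨w, g, p, q, h1.pairs.swap23.swap34, hh, hp.2⟩ hu
  · exact absurd ⟨u, g, p, q, h1.pairs.swap23.swap34.swap23, hh, hp.1, hp.2.2⟩ hw
  · refine ⟨p, q, ⟨hp.1, hp.2.1⟩, ⟨hq.1, hq.2.1⟩, hh, h2.2.2.2.2.2, ?_, ?_, ?_, ?_,
      hh.2.2.2.2.2⟩
    · exact h.cis.cover2 h1 h2.2.1 h2.2.2.2.1 hh.2.1 hh.2.2.2.1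
    · exact h.cis.cover2 h1 h2.2.1 h2.2.2.2.1 hh.2.2.1 hh.2.2.2.2.1
    · exact h.cis.cover2 h1 h2.2.2.1 h2.2.2.2.2.1 hh.2.1 hh.2.2.2.1
    · exact h.cis.cover2 h1 h2.2.2.1 h2.2.2.2.2.1 hh.2.2.1 hh.2.2.2.2.1

/-- If `ca` were doubled, `v` and `a` would be the only doubled neighbours of `c`, so `cd` would not
be doubled. Then `exists_opposite` at `d` makes `ed` doubled, so `ef` is not, and the same lemma at
`f` makes `cd` doubled after all. -/
theorem not_dbl {v a b c d e f g : V} (hP : G.LinePath v a b c d e f g) : ¬ G.Dbl c a := by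
  intro hca
  have hne := hP.ne
  have hva : v ≠ a := hP.fst.2.1.ne
  have hvd : v ≠ d := hP.mid.2.1.ne
  have hvf : v ≠ f := hP.lst.2.1.ne
  have hcd : ¬ G.Dbl c d := fun hh =>
    (h.eq_or_eq hP.dbl.symm hca hva hh).elim hvd.symm hne.1.2.2.1.symm
  have hvd' : ¬ G.Dbl v d := fun hh =>
    (hP.eq_of_dbl h.cis hh).elim hne.2.2.1.1.symm hne.2.2.2.1.1
  have hed : G.Dbl e d := by
    obtain ⟨x, y, hx, -, hK, hK'⟩ := h.exists_opposite (u := v) (w := c) (f := d) (g := e)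
      hP.mid hP.fst (fun hh => hvd' hh.symm) (fun hh => hcd hh.symm)
    exact Dbl.symm ⟨v, c, x, y, hP.mid.pairs, hK, hx⟩
  have hev : G.Dbl e v := hP.reverse.dbl.symm
  obtain ⟨x, y, hx, hy, hK, hK'⟩ := h.exists_opposite (u := v) (w := e) (f := f) (g := g)
    (c := c) (d := d) hP.lst hP.mid.swap34.swap23
    (fun hh => (hP.eq_of_dbl h.cis hh.symm).elim hne.2.2.1.2.2.1.symm hne.2.2.2.2.1.1.symm)
    (fun hh => (h.eq_or_eq hev hed hvd hh.symm).elim hvf.symm hne.2.2.2.1.2.1.symm)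
  exact hcd ⟨v, e, x, y, hP.mid.swap34.swap23.pairs, hK', hx⟩

theorem exists_layer {v a b c d e f g : V} (hP : G.LinePath v a b c d e f g) :
    ∃ x y, (x ≠ v ∧ x ≠ c) ∧ (y ≠ v ∧ y ≠ c) ∧ G.K4 a b x y ∧ G.K4 d e x y :=
  h.exists_opposite hP.fst hP.mid
    (fun hh => (hP.eq_of_dbl h.cis hh.symm).elim hP.ne.1.2.1 hP.ne.1.2.2.2.1)
    (fun hh => h.not_dbl hP hh.symm)

theorem dbl_opposite {v a b c d e f g : V} (hP : G.LinePath v a b c d e f g) : G.Dbl d e := by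
  obtain ⟨x, y, hx, hy, hK, hK'⟩ := h.exists_layer hP
  exact ⟨v, c, x, y, hP.mid.pairs, hK', hx⟩

/-- The path and its reverse supply the two sides of the 4-cycle that avoid `v`. -/
theorem fr4_of_linePath {v a b c d e f g : V} (hP : G.LinePath v a b c d e f g) :
    G.Fr4 v c e d :=
  ⟨hP.mid.swap34, hP.dbl, (h.dbl_opposite hP).symm, hP.reverse.dbl,
    (h.dbl_opposite hP.reverse).symm⟩

/-- The vertices adjacent to the two ends of an edge of a layer lie in the layer or in the other
clique through the edge. -/
theorem eq_of_adj_adj {p q r s a b u : V} (hF : G.Fr4 p q r s) (hK : G.K4 p q a b)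
    (ha : a ≠ r) (ha' : a ≠ s) (hp : G.Adj p u) (hq : G.Adj q u) :
    u = a ∨ u = b ∨ u = r ∨ u = s := by
  obtain ⟨a', b', d, f, g, hP⟩ := h.exists_linePath hF.2.1 hF.2.2.2.1 hF.1.2.2.2.1.ne
  obtain rfl : d = s :=
    h.cis.near4 hF.1 hP.mid.2.1 hP.mid.2.2.2.1 hP.mid.2.2.2.2.2.symm
  have hne := hP.ne
  have key : ∀ u, G.Adj p u → G.Adj q u → u = a' ∨ u = b' ∨ u = r ∨ u = d := by
    intro u hp hq
    have h1 := (hP.adj_iff u).1 hp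
    have h2 := (hP.not_adj h.cis).2.2.1
    have h3 : ¬ G.Adj q g := fun hh =>
      hne.2.2.1.2.2.1 (h.cis.near4 hP.lst.swap34 hP.fst.1 hP.mid.2.2.2.2.1.symm hh.symm)
    have := hq.ne
    grind
  have h1 := key u hp hq
  have h2 := key a hK.2.1 hK.2.2.2.1
  have h3 : a = a' → b = b' := by
    rintro rfl
    exact h.cis.near4 hP.fst hK.2.2.1 hK.2.2.2.2.1 hK.2.2.2.2.2
  have h4 : a = b' → b = a' := by
    rintro rfl
    exact h.cis.near4 hP.fst.swap34 hK.2.2.1 hK.2.2.2.2.1 hK.2.2.2.2.2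
  grind

/-- The other clique on `pq` gives `a, b`, and `exists_layer` gives `x, y` beyond `rs`. Neither `ap`
nor `aq` is doubled, so the layer of `a` lies on the far side of `ab`, and `eq_of_adj_adj` places
`x` and `y` in it. -/
theorem exists_next {p q r s : V} (hF : G.Fr4 p q r s) : ∃ a b x y, G.Fr4 a x b y ∧
    G.K4 p q a b ∧ G.K4 r s x y ∧ (∀ u ∈ [a, b, x, y], u ∉ [p, q, r, s]) := by
  obtain ⟨a, b, d, f, g, hP⟩ := h.exists_linePath hF.2.1 hF.2.2.2.1 hF.1.2.2.2.1.ne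
  obtain rfl : d = s :=
    h.cis.near4 hF.1 hP.mid.2.1 hP.mid.2.2.2.1 hP.mid.2.2.2.2.2.symm
  have hne := hP.ne
  obtain ⟨x, y, hx, hy, hab, hdr⟩ := h.exists_layer hP
  have hpa := hP.fst.2.1.ne
  have hpb := hP.fst.2.2.1.ne
  have dab : G.Dbl a b := ⟨p, q, x, y, hP.fst.pairs, hab, hx⟩
  have dxy : G.Dbl x y := ⟨a, b, d, r, hab.pairs, hdr.pairs, hne.1.2.2.1.symm, hne.2.1.2.1.symm⟩
  have dap : ¬ G.Dbl a p := fun hh =>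
    (hP.eq_of_dbl h.cis hh.symm).elim hne.1.2.1 hne.1.2.2.2.1
  have daq : ¬ G.Dbl a q := fun hh => h.not_dbl hP hh.symm
  obtain ⟨e, hea, heb⟩ : ∃ e, G.Dbl a e ∧ e ≠ b := by
    obtain ⟨_, _, c', _, e', _, _, hQ⟩ := h.exists_path a
    by_cases hc : c' = b
    · exact ⟨e', hQ.reverse.dbl, fun hh => hQ.ne.2.2.1.2.1 (hc.trans hh.symm)⟩
    · exact ⟨c', hQ.dbl, hc⟩
  obtain ⟨a', b', d', f', g', hQ⟩ := h.exists_linePath dab hea heb.symm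
  have hFa := h.fr4_of_linePath hQ
  have hpe : p ≠ e := by rintro rfl; exact dap hea
  have hqe : q ≠ e := by rintro rfl; exact daq hea
  have hpd' : p ≠ d' := by
    rintro rfl
    exact hqe (h.cis.near4 hQ.mid hP.fst.pairs.2.2.1 hP.fst.pairs.2.2.2.2.1 hP.fst.1)
  have hex := h.eq_of_adj_adj hFa hP.fst.pairs hpe hpd' hab.2.1 hab.2.2.2.1
  have hey := h.eq_of_adj_adj hFa hP.fst.pairs hpe hpd' hab.2.2.1 hab.2.2.2.2.1
  have fin : ∀ x y, G.K4 a b x y → G.K4 d r x y → x ≠ p ∧ x ≠ q → y ≠ p ∧ y ≠ q → G.Dbl x y →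
      x = e → y = d' → ∃ a b x y, G.Fr4 a x b y ∧
        G.K4 p q a b ∧ G.K4 r d x y ∧ (∀ u ∈ [a, b, x, y], u ∉ [p, q, r, d]) := by
    rintro x y hab hdr hx hy dxy rfl rfl
    refine ⟨a, b, x, y, ⟨hab.swap23, hea, hFa.2.2.2.2, dab, dxy⟩, hP.fst, hdr.swap12, ?_⟩
    have := hP.fst.2.2.2.1.ne
    have := hP.fst.2.2.2.2.1.ne
    have := hdr.2.1.ne
    have := hdr.2.2.1.ne
    have := hdr.2.2.2.1.ne
    have := hdr.2.2.2.2.1.ne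
    simp only [List.mem_cons, List.not_mem_nil, or_false]
    grind
  have := hab.2.2.2.2.2.ne
  have hcase : x = e ∧ y = d' ∨ y = e ∧ x = d' := by grind
  rcases hcase with ⟨h1, h2⟩ | ⟨h1, h2⟩
  · exact fin x y hab hdr hx hy dxy h1 h2
  · exact fin y x hab.swap34 hdr.swap34 hy hx dxy.symm h1 h2

end PathData

/-! ### Labelled layers and their cyclic arrangement -/

theorem zmod_two_cases : ∀ x : ZMod 2, x = 0 ∨ x = 1 := by decide

/-- A layer of four vertices labelled by `ZMod 2 × ZMod 2`. -/
structure Layer (G : SimpleGraph V) (F : ZMod 2 → ZMod 2 → V) : Prop where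
  adj : ∀ x y z w, ¬ (x = z ∧ y = w) → G.Adj (F x y) (F z w)
  dbl_left : ∀ x y, G.Dbl (F x y) (F (x + 1) y)
  dbl_right : ∀ x y, G.Dbl (F x y) (F x (y + 1))

/-- Consecutive layers. -/
structure Step (G : SimpleGraph V) (F F' : ZMod 2 → ZMod 2 → V) : Prop where
  adj : ∀ x y z, G.Adj (F x y) (F' y z)
  ne : ∀ x y z w, F x y ≠ F' z w

theorem Layer.of_fr4 {p q r s : V} (hF : G.Fr4 p q r s) :
    G.Layer fun x y : ZMod 2 => if x = 0 then (if y = 0 then p else r)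
      else if y = 0 then q else s := by
  obtain ⟨⟨a1, a2, a3, a4, a5, a6⟩, d1, d2, d3, d4⟩ := hF
  constructor
  · intro x y z w
    rcases zmod_two_cases x with rfl | rfl <;> rcases zmod_two_cases y with rfl | rfl <;>
      rcases zmod_two_cases z with rfl | rfl <;> rcases zmod_two_cases w with rfl | rfl <;>
      simp [a1, a2, a3, a4, a5, a6, a1.symm, a2.symm, a3.symm, a4.symm, a5.symm, a6.symm]
  · intro x y
    rcases zmod_two_cases x with rfl | rfl <;> rcases zmod_two_cases y with rfl | rfl <;>
      simp [d1, d2, d1.symm, d2.symm, show (1 : ZMod 2) + 1 = 0 from rfl]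
  · intro x y
    rcases zmod_two_cases x with rfl | rfl <;> rcases zmod_two_cases y with rfl | rfl <;>
      simp [d3, d4, d3.symm, d4.symm, show (1 : ZMod 2) + 1 = 0 from rfl]

theorem Layer.fr4 {F : ZMod 2 → ZMod 2 → V} (hF : G.Layer F) (x y : ZMod 2) :
    G.Fr4 (F x y) (F (x + 1) y) (F x (y + 1)) (F (x + 1) (y + 1)) := by
  refine ⟨⟨hF.adj _ _ _ _ ?_, hF.adj _ _ _ _ ?_, hF.adj _ _ _ _ ?_, hF.adj _ _ _ _ ?_,
    hF.adj _ _ _ _ ?_, hF.adj _ _ _ _ ?_⟩, hF.dbl_left _ _, hF.dbl_left _ _, hF.dbl_right _ _,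
    hF.dbl_right _ _⟩ <;> simp

theorem PathData.exists_layer_next (h : PathData G) {F : ZMod 2 → ZMod 2 → V} (hF : G.Layer F) :
    ∃ F', G.Layer F' ∧ G.Step F F' := by
  obtain ⟨a, b, x, y, hab, h1, h2, h3⟩ := h.exists_next (hF.fr4 0 0)
  refine ⟨_, Layer.of_fr4 hab, ?_, ?_⟩
  · obtain ⟨-, b1, b2, b3, b4, -⟩ := h1
    obtain ⟨-, c1, c2, c3, c4, -⟩ := h2
    simp only [zero_add] at *
    intro x y z
    rcases zmod_two_cases x with rfl | rfl <;> rcases zmod_two_cases y with rfl | rfl <;>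
      rcases zmod_two_cases z with rfl | rfl <;> simp [*]
  · simp only [zero_add, List.mem_cons, List.not_mem_nil, or_false] at h3
    intro x y z w
    rcases zmod_two_cases x with rfl | rfl <;> rcases zmod_two_cases y with rfl | rfl <;>
      rcases zmod_two_cases z with rfl | rfl <;> rcases zmod_two_cases w with rfl | rfl <;> simp <;> grind

/-- Two layers with a common vertex agree up to a symmetry of the square. -/
theorem PathData.layer_eq (h : PathData G) {F F' : ZMod 2 → ZMod 2 → V} (hF : G.Layer F)
    (hF' : G.Layer F') {x y z w : ZMod 2} (he : F x y = F' z w) :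
    (∀ i j, F (x + i) (y + j) = F' (z + i) (w + j)) ∨
      ∀ i j, F (x + i) (y + j) = F' (z + j) (w + i) := by
  have hK := (hF.fr4 x y).1
  have h1 := hF.dbl_left x y
  have h2 := hF.dbl_right x y
  have hne : F (x + 1) y ≠ F x (y + 1) := (hF.adj _ _ _ _ (by simp)).ne
  have hne' : F' (z + 1) w ≠ F' z (w + 1) := (hF'.adj _ _ _ _ (by simp)).ne
  have h3 := h.eq_or_eq h1 h2 hne (he ▸ hF'.dbl_left z w)
  have h4 := h.eq_or_eq h1 h2 hne (he ▸ hF'.dbl_right z w)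
  have a1 : G.Adj (F' z w) (F' (z + 1) (w + 1)) := hF'.adj _ _ _ _ (by simp)
  have a2 : G.Adj (F' (z + 1) w) (F' (z + 1) (w + 1)) := hF'.adj _ _ _ _ (by simp)
  have a3 : G.Adj (F' z (w + 1)) (F' (z + 1) (w + 1)) := hF'.adj _ _ _ _ (by simp)
  rcases h3 with h3 | h3 <;> rcases h4 with h4 | h4
  · exact absurd (h3.trans h4.symm) hne'
  · left
    have h5 := h.cis.near4 hK (he ▸ a1) (h3 ▸ a2) (h4 ▸ a3)
    intro i j
    rcases zmod_two_cases i with rfl | rfl <;> rcases zmod_two_cases j with rfl | rfl <;>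
      simp [*]
  · right
    have h5 := h.cis.near4 hK (he ▸ a1) (h4 ▸ a3) (h3 ▸ a2)
    intro i j
    rcases zmod_two_cases i with rfl | rfl <;> rcases zmod_two_cases j with rfl | rfl <;>
      simp [*]
  · exact absurd (h3.trans h4.symm) hne'

/-- A cyclic sequence of pairwise disjoint layers. -/
structure CyclicLayers (G : SimpleGraph V) (g : ZMod n → ZMod 2 → ZMod 2 → V) : Prop where
  layer : ∀ i, G.Layer (g i)
  adj : ∀ i x y z, G.Adj (g i x y) (g (i + 1) y z)
  index_eq : ∀ i j x y z w, g i x y = g j z w → i = j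

/-- Iterating the successor, some layer meets an earlier one; at the first such return the two
layers coincide up to a symmetry of the square. Showing it to be a translation lets one relabelled
layer close the cycle. -/
theorem PathData.exists_cyclicLayers [Finite V] (h : PathData G) :
    ∃ n, 2 ≤ n ∧ ∃ g : ZMod n → ZMod 2 → ZMod 2 → V, G.CyclicLayers g := by
  classical
  have := h.cis.exists_vertex
  obtain ⟨F₀, hF₀⟩ : ∃ F, G.Layer F := by
    obtain ⟨v⟩ := this
    obtain ⟨a, b, c, d, e, f, g, hP⟩ := h.exists_path v
    exact ⟨_, Layer.of_fr4 (h.fr4_of_linePath hP)⟩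
  choose! N hN using fun F (hF : G.Layer F) => h.exists_layer_next hF
  let s : ℕ → ZMod 2 → ZMod 2 → V := fun i => N^[i] F₀
  have hs : ∀ i, G.Layer (s i) := by
    intro i
    induction i with
    | zero => exact hF₀
    | succ i ih =>
      simp only [s, Function.iterate_succ_apply']
      exact (hN _ ih).1
  have hstep : ∀ i, G.Step (s i) (s (i + 1)) := by
    intro i
    have := (hN _ (hs i)).2
    simpa only [s, Function.iterate_succ_apply'] using this
  have hex : ∃ j, ∃ i < j, ∃ x y z w, s i x y = s j z w := by
    obtain ⟨i, j, hij, he⟩ := Finite.exists_ne_map_eq_of_infinite (fun i => s i 0 0)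
    rcases lt_or_gt_of_ne hij with hlt | hlt
    · exact ⟨j, i, hlt, 0, 0, 0, 0, he⟩
    · exact ⟨i, j, hlt, 0, 0, 0, 0, he.symm⟩
  obtain ⟨i₀, hi₀, x, y, z, w, he⟩ := Nat.find_spec hex
  have hmin : ∀ i j, i < j → j < Nat.find hex → ∀ x y z w, s i x y ≠ s j z w :=
    fun i j hij hj x y z w hh => Nat.find_min hex hj ⟨i, hij, x, y, z, w, hh⟩
  -- The return occurs at index `i₀ + n + 1`, so the cycle has `n + 1` layers.
  obtain ⟨n, hn⟩ := Nat.exists_eq_add_of_lt hi₀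
  rw [hn] at he hmin
  let t : ℕ → ZMod 2 → ZMod 2 → V := fun i => s (i₀ + i)
  have htl : ∀ i, G.Layer (t i) := fun i => hs _
  have hts : ∀ i, G.Step (t i) (t (i + 1)) := fun i => hstep _
  have htd : ∀ i j, i < j → j ≤ n → ∀ x y z w, t i x y ≠ t j z w := fun i j hij hj =>
    hmin _ _ (by omega) (by omega)
  have hte : t 0 x y = t (n + 1) z w := he
  clear_value t
  clear hmin he hn hi₀ hex hstep hs
  have hn0 : n ≠ 0 := by
    rintro rfl
    exact (hts 0).ne _ _ _ _ hte
  have hsame : ∀ i j, t 0 (x + i) (y + j) = t (n + 1) (z + i) (w + j) := by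
    -- A coordinate swap would join a vertex of layer `n` to both ends of a doubled edge of layer
    -- `0`, whose common neighbours lie in layers `0` and `1`. For `n = 1`, the label `y + 1`
    -- supplies a third neighbour in layer `0`, against `near4`.
    refine (h.layer_eq (htl 0) (htl (n + 1)) hte).resolve_right fun hcr => ?_
    have hu : ∀ i, G.Adj (t 0 (x + i) y) (t n (y + 1) z) := by
      intro i
      have h1 := hcr i 0
      simp only [add_zero] at h1
      rw [h1]
      exact ((hts n).adj _ _ _).symm
    have a1 : G.Adj (t 0 x y) (t n (y + 1) z) := by simpa using hu 0
    have hK : G.K4 (t 0 x y) (t 0 (x + 1) y) (t 1 y 0) (t 1 y 1) :=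
      ⟨(htl 0).adj _ _ _ _ (by simp), (hts 0).adj _ _ _, (hts 0).adj _ _ _, (hts 0).adj _ _ _,
        (hts 0).adj _ _ _, (htl 1).adj _ _ _ _ (by simp)⟩
    have hn1 : n = 1 := by
      by_contra hn1
      have hlt : 1 < n := by omega
      rcases h.eq_of_adj_adj ((htl 0).fr4 x y) hK ((hts 0).ne _ _ _ _).symm
        ((hts 0).ne _ _ _ _).symm a1 (hu 1) with hh | hh | hh | hh
      · exact htd 1 n hlt le_rfl _ _ _ _ hh.symm
      · exact htd 1 n hlt le_rfl _ _ _ _ hh.symm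
      · exact htd 0 n (by omega) le_rfl _ _ _ _ hh.symm
      · exact htd 0 n (by omega) le_rfl _ _ _ _ hh.symm
    subst hn1
    have := h.cis.near4 ((htl 0).fr4 x y).1 a1 (hu 1) ((hts 0).adj _ _ _)
    exact (hts 0).ne _ _ _ _ this.symm
  -- relabel the last layer so that the sequence closes up
  let g : ℕ → ZMod 2 → ZMod 2 → V := fun i a b => if i = n then t n a (b + (z - x)) else t i a b
  have hgt : ∀ i a b, ∃ c, g i a b = t i a c := by
    intro i a b
    by_cases hi : i = n
    · exact ⟨b + (z - x), by simp [g, hi]⟩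
    · exact ⟨b, by simp [g, hi]⟩
  have hgl : ∀ i, G.Layer (g i) := by
    intro i
    by_cases hi : i = n
    · subst hi
      constructor
      · intro a b c d hne
        simp only [g, if_true]
        exact (htl i).adj _ _ _ _ (by simpa using hne)
      · intro a b
        simp only [g, if_true]
        exact (htl i).dbl_left _ _
      · intro a b
        simp only [g, if_true]
        rw [add_right_comm]
        exact (htl i).dbl_right _ _
    · have : g i = t i := by
        funext a b
        simp [g, hi]
      rw [this]
      exact htl i
  -- Edges into layer `n` constrain only its first label, so translating the second label preserves
  -- them.
  have hgs : ∀ i < n, ∀ a b c, G.Adj (g i a b) (g (i + 1) b c) := by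
    intro i hi a b c
    have : g i a b = t i a b := by simp [g, hi.ne]
    rw [this]
    obtain ⟨d, hd⟩ := hgt (i + 1) b c
    rw [hd]
    exact (hts i).adj _ _ _
  have hgc : ∀ a b c, G.Adj (g n a b) (g 0 b c) := by
    intro a b c
    have e0 : g 0 b c = t 0 b c := by simp [g, hn0.symm]
    have e1 : t 0 b c = t (n + 1) (b + (z - x)) (w + (c - y)) := by
      have := hsame (b - x) (c - y)
      rw [add_sub_cancel, add_sub_cancel] at this
      rw [this]
      congr 1
      ring
    rw [e0, e1]
    simp only [g, if_true]
    exact (hts n).adj _ _ _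
  have hgd : ∀ i j, i ≤ n → j ≤ n → ∀ a b c d, g i a b = g j c d → i = j := by
    intro i j hi hj a b c d hh
    obtain ⟨b', hb⟩ := hgt i a b
    obtain ⟨d', hd⟩ := hgt j c d
    rw [hb, hd] at hh
    by_contra hij
    rcases lt_or_gt_of_ne hij with hlt | hlt
    · exact htd i j hlt hj _ _ _ _ hh
    · exact htd j i hlt hi _ _ _ _ hh.symm
  refine ⟨n + 1, by omega, fun i => g i.val, fun i => hgl _, ?_, ?_⟩
  · intro i a b c
    have hlt := ZMod.val_lt i
    have : Fact (1 < n + 1) := ⟨by omega⟩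
    have hv := ZMod.val_add i 1
    rw [ZMod.val_one] at hv
    by_cases hi : i.val = n
    · rw [hi, Nat.mod_self] at hv
      simp only [hv, hi]
      exact hgc a b c
    · rw [Nat.mod_eq_of_lt (by omega)] at hv
      simp only [hv]
      exact hgs _ (by omega) a b c
  · intro i j a b c d hh
    have h1 := ZMod.val_lt i
    have h2 := ZMod.val_lt j
    exact ZMod.val_injective _ (hgd _ _ (by omega) (by omega) _ _ _ _ hh)

namespace CyclicLayers

variable {g : ZMod n → ZMod 2 → ZMod 2 → V}

theorem eq_iff (hg : G.CyclicLayers g) {i j : ZMod n} {x y z w : ZMod 2} :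
    g i x y = g j z w ↔ i = j ∧ x = z ∧ y = w := by
  constructor
  · intro hh
    obtain rfl := hg.index_eq _ _ _ _ _ _ hh
    refine ⟨rfl, ?_⟩
    by_contra hne
    exact ((hg.layer i).adj _ _ _ _ hne).ne hh
  · rintro ⟨rfl, rfl, rfl⟩
    rfl

theorem adj_pred (hg : G.CyclicLayers g) (i : ZMod n) (x y z : ZMod 2) :
    G.Adj (g (i - 1) z x) (g i x y) := by
  have := hg.adj (i - 1) z x y
  rwa [sub_add_cancel] at this

/-- Layer `1` would both precede and follow layer `0`, so `g 1 0 1` would have three neighbours in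
layer `0`, against `near4`. -/
theorem ne_two (hg : G.CyclicLayers g) (h : CISData G 4 7) : n ≠ 2 := by
  rintro rfl
  have h1 : ∀ z, G.Adj (g 0 1 z) (g 1 0 1) := fun z => by
    have := hg.adj 1 0 1 z
    exact this.symm
  have h2 : G.Adj (g 0 0 0) (g 1 0 1) := hg.adj 0 0 0 1
  have := h.near4 ((hg.layer 0).fr4 1 0).1.swap23 (h1 0) (h1 (0 + 1)) h2
  rw [hg.eq_iff] at this
  exact absurd this.1 (by decide)

/-- The layers `i - 1`, `i`, `i + 1` are distinct for `n > 2`, and they already contribute `2 + 3 +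
2 = 7` neighbours. -/
theorem adj_cases (hg : G.CyclicLayers g) (h : CISData G 4 7) (hn : 2 < n) {i : ZMod n}
    {x y : ZMod 2} {u : V} (hu : G.Adj (g i x y) u) :
    (∃ z w, ¬ (x = z ∧ y = w) ∧ u = g i z w) ∨ (∃ z, u = g (i + 1) y z) ∨
      ∃ z, u = g (i - 1) z x := by
  classical
  have : Fact (1 < n) := ⟨by omega⟩
  have e1 : i ≠ i + 1 := by simp
  have e2 : i ≠ i - 1 := fun hh => one_ne_zero (α := ZMod n) (by linear_combination hh)
  have e3 : i + 1 ≠ i - 1 := by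
    intro hh
    have h2 : (2 : ZMod n) = 0 := by linear_combination hh
    have := (ZMod.natCast_eq_zero_iff 2 n).1 (by exact_mod_cast h2)
    exact absurd (Nat.le_of_dvd (by norm_num) this) (by omega)
  have hl := (hg.layer i).adj
  have h01 : (0 : ZMod 2) ≠ 1 := by decide
  rw [h.nbr_eq (N := {g i (x + 1) y, g i x (y + 1), g i (x + 1) (y + 1), g (i + 1) y 0,
    g (i + 1) y 1, g (i - 1) 0 x, g (i - 1) 1 x}) (by
      simp only [mem_insert, mem_singleton]
      rintro u (rfl | rfl | rfl | rfl | rfl | rfl | rfl)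
      · exact hl _ _ _ _ (by simp)
      · exact hl _ _ _ _ (by simp)
      · exact hl _ _ _ _ (by simp)
      · exact hg.adj _ _ _ _
      · exact hg.adj _ _ _ _
      · exact (hg.adj_pred _ _ _ _).symm
      · exact (hg.adj_pred _ _ _ _).symm) (by
      rw [card_insert_of_notMem, card_insert_of_notMem, card_insert_of_notMem,
          card_insert_of_notMem, card_insert_of_notMem, card_insert_of_notMem, card_singleton] <;>
          simp [hg.eq_iff, e1, e2, e3])] at hu
  simp only [mem_insert, mem_singleton] at hu
  rcases hu with rfl | rfl | rfl | rfl | rfl | rfl | rfl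
  · exact Or.inl ⟨_, _, by simp, rfl⟩
  · exact Or.inl ⟨_, _, by simp, rfl⟩
  · exact Or.inl ⟨_, _, by simp, rfl⟩
  · exact Or.inr (Or.inl ⟨_, rfl⟩)
  · exact Or.inr (Or.inl ⟨_, rfl⟩)
  · exact Or.inr (Or.inr ⟨_, rfl⟩)
  · exact Or.inr (Or.inr ⟨_, rfl⟩)

/-- The vertices `g i 0 0` would form a triangle. A fourth vertex completing it to a clique shares a
layer with one of them, and the labels force it to equal that one. -/
theorem ne_three (hg : G.CyclicLayers g) (h : CISData G 4 7) : n ≠ 3 := by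
  rintro rfl
  -- vertices adjacent to both neighbours of a layer in a triangle
  have key : ∀ i x y, G.Adj (g i x y) (g (i + 1) 0 0) → G.Adj (g i x y) (g (i - 1) 0 0) →
      x = 0 ∧ y = 0 := by
    intro i x y h1 h2
    have e1 : ∀ i : ZMod 3, i + 1 ≠ i := by decide
    have e2 : ∀ i : ZMod 3, i + 1 ≠ i - 1 := by decide
    have e3 : ∀ i : ZMod 3, i - 1 ≠ i := by decide
    have c1 := hg.adj_cases h (by norm_num) h1
    have c2 := hg.adj_cases h (by norm_num) h2
    simp only [hg.eq_iff] at c1 c2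
    have := e1 i
    have := e2 i
    have := e3 i
    grind
  have a1 : G.Adj (g 0 0 0) (g 1 0 0) := hg.adj 0 0 0 0
  have a2 : G.Adj (g 1 0 0) (g 2 0 0) := hg.adj 1 0 0 0
  have a3 : G.Adj (g 2 0 0) (g 0 0 0) := hg.adj 2 0 0 0
  obtain ⟨d, hK⟩ := h.tri4 a1 a3.symm a2
  obtain ⟨-, -, d3, -, d5, d6⟩ := hK
  have done : ∀ i x y, d = g i x y → False := by
    intro i x y hd
    have h3 : ∀ i : ZMod 3, i = 0 ∨ i = 1 ∨ i = 2 := by decide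
    rcases h3 i with rfl | rfl | rfl
    · obtain ⟨rfl, rfl⟩ := key 0 x y (hd ▸ d5.symm) (hd ▸ d6.symm)
      exact d3.ne hd.symm
    · obtain ⟨rfl, rfl⟩ := key 1 x y (hd ▸ d6.symm) (hd ▸ d3.symm)
      exact d5.ne hd.symm
    · obtain ⟨rfl, rfl⟩ := key 2 x y (hd ▸ d3.symm) (hd ▸ d5.symm)
      exact d6.ne hd.symm
  rcases hg.adj_cases h (by norm_num) d3 with ⟨z, w, -, hd⟩ | ⟨z, hd⟩ | ⟨z, hd⟩ <;>
    exact done _ _ _ hd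

theorem nonempty_iso (hg : G.CyclicLayers g) (h : CISData G 4 7) (hG : G.Connected)
    (hn : 2 ≤ n) : 4 ≤ n ∧ Nonempty (G ≃g graphQ n) := by
  have h2 := hg.ne_two h
  have h3 := hg.ne_three h
  refine ⟨by omega, ?_⟩
  have : Fact (1 < n) := ⟨by omega⟩
  refine hG.nonempty_iso_of_closed (fun p => g p.1 p.2.1 p.2.2) ?_ ?_ ?_
  · rintro ⟨i, x, y⟩ ⟨j, z, w⟩ hh
    obtain ⟨rfl, rfl, rfl⟩ := hg.eq_iff.1 hh
    rfl
  · rintro ⟨i, x, y⟩ ⟨j, z, w⟩ hh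
    simp only [graphQ, praegerXu, sup_adj, fromRel_adj] at hh
    rcases hh with ⟨-, ⟨rfl, rfl⟩ | ⟨rfl, rfl⟩⟩ | ⟨hne, hij⟩
    · exact hg.adj _ _ _ _
    · exact (hg.adj _ _ _ _).symm
    · obtain rfl : i = j := by tauto
      exact (hg.layer i).adj _ _ _ _ (by rintro ⟨rfl, rfl⟩; exact hne rfl)
  · rintro ⟨i, x, y⟩ v hv
    rcases hg.adj_cases h (by omega) hv with ⟨z, w, hne, hd⟩ | ⟨z, hd⟩ | ⟨z, hd⟩
    · refine ⟨(i, z, w), Or.inr ?_, hd.symm⟩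
      rw [fromRel_adj]
      refine ⟨?_, Or.inl rfl⟩
      intro hh
      simp only [Prod.mk.injEq, true_and] at hh
      exact hne hh
    · refine ⟨(i + 1, y, z), Or.inl ?_, hd.symm⟩
      rw [praegerXu, fromRel_adj]
      exact ⟨by simp, Or.inl ⟨rfl, rfl⟩⟩
    · refine ⟨(i - 1, z, x), Or.inl ?_, hd.symm⟩
      rw [praegerXu, fromRel_adj]
      refine ⟨fun hh => one_ne_zero (α := ZMod n) ?_, Or.inr ⟨by simp, rfl⟩⟩
      simp only [Prod.mk.injEq] at hh
      linear_combination hh.1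

end CyclicLayers

theorem CISData.exists_iso_graphQ [Finite V] (h : CISData G 4 7) (hG : G.Connected)
    (ht : ∀ v c, ¬ G.Twin v c) : ∃ n : ℕ, 4 ≤ n ∧ Nonempty (G ≃g graphQ n) := by
  have hP : PathData G := ⟨h, fun v =>
    (h.twin_or_linePath v).resolve_left fun ⟨c, hc⟩ => ht v c hc⟩
  obtain ⟨n, hn, g, hg⟩ := hP.exists_cyclicLayers
  exact ⟨n, hg.nonempty_iso h hG hn⟩

end SimpleGraph

/-! ### Assembly by clique size and valency -/

theorem mainTheorem3 {V : Type*} [Fintype V] (G : SimpleGraph V) [DecidableRel G.Adj] (k : ℕ)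
    (hconn : G.Connected) (hreg : G.IsRegularOfDegree k) (hirr : G.IsIrreducible)
    (hwc : G.IsWellCovered) (hcwc : G.IsCoWellCovered) (hcis : G.IsCIS) (hk : k ≤ 7) :
    G = ⊤ ∨
    Nonempty (G ≃g (completeBipartiteGraph (Fin 3) (Fin 3)).lineGraph) ∨
    Nonempty (G ≃g (completeBipartiteGraph (Fin 4) (Fin 4)).lineGraph) ∨
    Nonempty (G ≃g (SimpleGraph.cycleGraph 4).lexProduct (⊤ : SimpleGraph (Fin 2))) ∨
    Nonempty (G ≃g
      (completeBipartiteGraph (Fin 3) (Fin 3)).lexProduct (⊤ : SimpleGraph (Fin 2))) ∨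
    ∃ n : ℕ, 4 ≤ n ∧ Nonempty (G ≃g SimpleGraph.graphQ n) := by
  have := hconn.nonempty
  obtain ⟨m, h⟩ := SimpleGraph.exists_cisData hreg hirr hcwc hcis
  by_cases hm2 : m ≤ 2
  · exact Or.inl (h.eq_top_of_le_two hconn hm2)
  by_cases hkm : k < m
  · exact Or.inl (h.eq_top_of_lt hconn hkm)
  right
  obtain rfl | rfl | hm5 : m = 3 ∨ m = 4 ∨ 5 ≤ m := by omega
  · left
    have heven := h.even_of_three
    obtain rfl | rfl | rfl | rfl | rfl : k = 3 ∨ k = 4 ∨ k = 5 ∨ k = 6 ∨ k = 7 := by omega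
    · exact absurd heven (by decide)
    · obtain ⟨e⟩ := h.gridData_three.exists_iso h hconn le_rfl
      obtain ⟨e'⟩ := SimpleGraph.nonempty_rookGraph_iso 3
      exact ⟨e.trans e'⟩
    · exact absurd heven (by decide)
    · exact h.false_of_three_six.elim
    · exact absurd heven (by decide)
  · right
    obtain rfl | rfl | rfl | rfl : k = 4 ∨ k = 5 ∨ k = 6 ∨ k = 7 := by omega
    · exact absurd rfl (h.ne_of_pos (by norm_num))
    · exact Or.inr (Or.inl (h.nonempty_iso_four_five hconn))
    · left
      obtain ⟨e⟩ := h.gridData_four.exists_iso h hconn (by norm_num)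
      obtain ⟨e'⟩ := SimpleGraph.nonempty_rookGraph_iso 4
      exact ⟨e.trans e'⟩
    · right; right
      by_cases ht : ∃ v c, G.Twin v c
      · obtain ⟨v, c, ht⟩ := ht
        exact Or.inl (h.nonempty_iso_of_twin hconn ht)
      · push Not at ht
        exact Or.inr (h.exists_iso_graphQ hconn ht)
  · exfalso
    by_cases hkm' : k ≤ m + 1
    · exact h.false_of_five_le_of_le_succ hm5 (by omega) hkm'
    -- Here `m + 2 ≤ k ≤ 7` and `m ≥ 5`.
    · obtain rfl : m = 5 := by omega
      obtain rfl : k = 7 := by omega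
      exact h.false_of_five_seven
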